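/- Conventions. A real-valued Hermitian form on a complex vector space $V$ is a function $Q[v]=Q[v,v]$ with $Q[\cdot,\cdot]$ a symmetric sesquilinear form; $\operatorname{sign} Q$ is the number of its positive squares minus the number of its negative squares. Let $(S,h)$ be a superhermitian space: $S$ is a complex vector space of finite even dimension $2n$ and $h$ is a nondegenerate Hermitian form on $S$ of zero signature. A subspace $L\subset S$ is superlagrangian if $\dim L=n$ and $h$ vanishes identically on $L$; $\mathscr U$ denotes the set of all superlagrangian subspaces. For $P_0\in\mathscr U$ put $\mathscr S(P_0)=\{P\in\mathscr U: P\cap P_0\neq 0\}$. For complementary $P_0,P_1\in\mathscr U$, every $P\in\mathscr U$ complementary to $P_1$ is the graph of a unique linear map $T_P\colon P_0\to P_1$, and the chart $\varphi_{P_0,P_1}$ maps $P$ to the Hermitian form $u\mapsto h[u-iT_Pu]$ on $P_0$; these charts form an atlas of $\mathscr U$, and define its topology and the differentiability of paths in $\mathscr U$. For a differentiable path $p\colon[a,b]\to\mathscr U$ and $t_0\in(a,b)$ let $Q(p(t_0),p'(t_0))$ be the Hermitian form $v\mapsto \frac{d}{dt}\big|_{t=t_0}\varphi_{p(t_0),P_1}(p(t))[v]$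 on $p(t_0)$, where $P_1\in\mathscr U$ is any complement of $p(t_0)$ (the form does not depend on $P_1$). A crossing is an instant $t_0$ with $p(t_0)\in\mathscr S(P_0)$; its crossing form is $\Gamma(p,P_0,t_0)=Q(p(t_0),p'(t_0))|_{p(t_0)\cap P_0}$, and it is regular if this form is nonsingular. A path is admissible if $p(a),p(b)\notin\mathscr S(P_0)$. For fixed $P_0\in\mathscr U$ the EM-index $\mu_{EM}(\cdot,P_0)$ is the integer-valued map on the admissible continuous paths $p\colon[a,b]\to\mathscr U$ (for all $a<b$) determined by: (i) it is invariant under homotopies through admissible paths; (ii) $\mu_{EM}(p,P_0)=\mu_{EM}(p|_{[a,c]},P_0)+\mu_{EM}(p|_{[c,b]},P_0)$ whenever $a<c<b$ and $p(c)\notin\mathscr S(P_0)$; (iii) if $P_1\in\mathscr U$ is complementary to $P_0$ and $p$ is an admissible differentiable path of subspaces complementary to $P_1$ that has no crossing except possibly a regular one at $t_0\in(a,b)$, then, with $H(t)=\varphi_{P_0,P_1}(p(t))$, $\mu_{EM}(p,P_0)=\tfrac12\operatorname{sign}H(t_0+\varepsilon)-\tfrac12\operatorname{sign}H(t_0-\varepsilon)$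 for every $\varepsilon>0$ with $t_0\pm\varepsilon\in[a,b]$. Proposition. Let $(S,h)$ be a superhermitian space and $P_0\in\mathscr U$. A map satisfying (i)–(iii) exists, and for every admissible differentiable path $p\colon[a,b]\to\mathscr U$, $a<b$, having only regular crossings with $\mathscr S(P_0)$, the crossings are finite in number and $$\mu_{EM}(p,P_0)=\sum_{t_0\in(a,b)}\operatorname{sign}\Gamma(p,P_0,t_0),$$ where the sum runs over all crossing instants $t_0$ of $p$. -/

import Mathlib

open Set

noncomputable section

namespace EMIndex

section HermitianForms

variable {V : Type*} [AddCommGroup V] [Module ℂ V]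

/-- The largest dimension of a complex subspace on which the real-valued form `Q` is
positive definite. -/
def posIndex (Q : V → ℝ) : ℕ :=
  sSup {k : ℕ | ∃ W : Submodule ℂ V, Module.finrank ℂ W = k ∧ ∀ w ∈ W, w ≠ 0 → 0 < Q w}

/-- The signature of a real-valued Hermitian form: number of positive squares minus
number of negative squares. -/
def sign (Q : V → ℝ) : ℤ :=
  (posIndex Q : ℤ) - (posIndex (fun v => -Q v) : ℤ)

/-- A real-valued Hermitian form is nonsingular if its radical is trivial. For a Hermitian form
`Q[v] = Q[v, v]` one has `Q[v + w] = Q[v] + Q[w] + 2 Re Q[v, w]`, so that `v` is in the radical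
exactly when `Q[v + w] = Q[v] + Q[w]` for all `w`. -/
def IsNonsingular (Q : V → ℝ) : Prop :=
  ∀ v : V, (∀ w : V, Q (v + w) = Q v + Q w) → v = 0

end HermitianForms

variable {S : Type*} [AddCommGroup S] [Module ℂ S]

/-- The real-valued Hermitian form `h[v] = h(v, v)` of a symmetric sesquilinear form. -/
def realForm (h : S →ₗ⋆[ℂ] S →ₗ[ℂ] ℂ) (v : S) : ℝ := (h v v).re

/-- `h` is a superhermitian structure on `S`. -/
structure IsSuperhermitian (h : S →ₗ⋆[ℂ] S →ₗ[ℂ] ℂ) : Prop where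
  even_dim : Even (Module.finrank ℂ S)
  symm : h.IsSymm
  nondegenerate : h.Nondegenerate
  sign_eq_zero : sign (realForm h) = 0

/-- `L` is a superlagrangian subspace of `(S, h)`. -/
def IsSuperlagrangian (h : S →ₗ⋆[ℂ] S →ₗ[ℂ] ℂ) (L : Submodule ℂ S) : Prop :=
  2 * Module.finrank ℂ L = Module.finrank ℂ S ∧ ∀ v ∈ L, realForm h v = 0

/-- The set of all superlagrangian subspaces of `(S, h)`. -/
@[ext]
structure UManifold (h : S →ₗ⋆[ℂ] S →ₗ[ℂ] ℂ) where
  /-- The underlying subspace. -/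
  val : Submodule ℂ S
  property : IsSuperlagrangian h val

variable {h : S →ₗ⋆[ℂ] S →ₗ[ℂ] ℂ}

/-- Two superlagrangian subspaces are complementary. -/
def Compl (P P₁ : UManifold h) : Prop := IsCompl P.1 P₁.1

/-- The stratum of those superlagrangians which meet `P₀` in dimension `k`. -/
def stratum (P₀ : UManifold h) (k : ℕ) : Set (UManifold h) :=
  {P | Module.finrank ℂ (P.1 ⊓ P₀.1 : Submodule ℂ S) = k}

/-- The variety `𝒮(P₀)`, the union of the strata with `1 ≤ k ≤ n`, where `2 n = dim S`. -/
def variety (P₀ : UManifold h) : Set (UManifold h) :=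
  ⋃ k ∈ Finset.Icc 1 (Module.finrank ℂ S / 2), stratum P₀ k

open Classical in
/-- The chart `φ_{P₀,P₁}`, defined on those `P` that are complementary to `P₁` (it is given the
value `0` elsewhere). Such a `P` is the graph of a linear map `T : P₀ → P₁`: the vector `u + T u` is
the projection of `u` on `P` along `P₁`. The chart maps `P` to the Hermitian form
`u ↦ h[j (u + T u)] = h[u - i T u]` on `P₀`, where `j` is the identity on `P₀` and the
multiplication by `-i` on `P₁`. -/
def chart (P₀ P₁ P : UManifold h) (u : P₀.1) : ℝ :=
  if hc : IsCompl P.1 P₁.1 then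
    realForm h ((u : S) - Complex.I • (P.1.projection P₁.1 hc (u : S) - (u : S)))
  else 0

/-- The topology of the manifold of superlagrangians, given by its atlas: it is generated by the
sets `{P | P complementary to P₁, φ_{P₀,P₁}(P) ∈ O}` for all complementary pairs `(P₀, P₁)` and all
open sets `O` of forms. (On the finite-dimensional space of Hermitian forms on `P₀` the only
Hausdorff vector space topology is that of pointwise convergence.) -/
instance instTopologicalSpaceUManifold : TopologicalSpace (UManifold h) :=
  TopologicalSpace.generateFrom
    {A | ∃ P₀ P₁ : UManifold h, Compl P₀ P₁ ∧ ∃ O : Set (P₀.1 → ℝ), IsOpen O ∧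
      A = {P | Compl P P₁ ∧ chart P₀ P₁ P ∈ O}}

/-- `p : [a, b] → 𝒰` is a differentiable path: it is continuous and its expression in every chart
of the atlas is differentiable. (Paths on `[a, b]` are represented by functions on `ℝ`, of which
only the restriction to `[a, b]` is relevant.) -/
def IsDifferentiablePath (a b : ℝ) (p : ℝ → UManifold h) : Prop :=
  ContinuousOn p (Icc a b) ∧
    ∀ t₀ ∈ Icc a b, ∀ P₀ P₁ : UManifold h, Compl P₀ P₁ → Compl (p t₀) P₁ →
      ∀ u : P₀.1, DifferentiableWithinAt ℝ (fun t => chart P₀ P₁ (p t) u) (Icc a b) t₀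

/-- The endpoints of the path are not in `𝒮(P₀)`. -/
def IsAdmissible (P₀ : UManifold h) (a b : ℝ) (p : ℝ → UManifold h) : Prop :=
  p a ∉ variety P₀ ∧ p b ∉ variety P₀

/-- The form vanishes as a sesquilinear form on a superlagrangian subspace. -/
theorem apply_eq_zero (hh : h.IsSymm) {L : Submodule ℂ S} (hL : ∀ v ∈ L, realForm h v = 0)
    {v w : S} (hv : v ∈ L) (hw : w ∈ L) : h v w = 0 := by
  have e1 := hL _ (L.add_mem hv hw)
  have e2 := hL _ (L.add_mem hv (L.smul_mem Complex.I hw))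
  have ev := hL _ hv
  have ew := hL _ hw
  have hs := hh.eq v w
  simp only [realForm, map_add, LinearMap.add_apply, LinearMap.map_smulₛₗ, LinearMap.smul_apply,
    smul_eq_mul, RingHom.id_apply, Complex.add_re, Complex.mul_re, Complex.conj_I, Complex.I_re,
    Complex.I_im, Complex.neg_re, Complex.neg_im, Complex.mul_im, Complex.add_im, ← hs, Complex.conj_re,
    Complex.conj_im] at e1 e2 ev ew
  apply Complex.ext <;> simp only [Complex.zero_re, Complex.zero_im] <;> linarith

/-- Every superlagrangian subspace has a complementary superlagrangian subspace. -/
theorem exists_compl [FiniteDimensional ℂ S] (hh : IsSuperhermitian h) (P : UManifold h) :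
    ∃ P₁ : UManifold h, Compl P P₁ := by
  obtain ⟨L, hd, hL⟩ := P
  obtain ⟨W, hW⟩ := L.exists_isCompl
  have hdW : Module.finrank ℂ W = Module.finrank ℂ L := by
    have := Submodule.finrank_add_eq_of_isCompl hW
    omega
  let f : L →ₗ⋆[ℂ] (W →ₗ[ℂ] ℂ) := h.domRestrict₁₂ L W
  let g : W →ₗ⋆[ℂ] (W →ₗ[ℂ] ℂ) := h.domRestrict₁₂ W W
  have hf0 : ∀ l : L, f l = 0 → l = 0 := by
    intro l hl
    have h0 : (l : S) = 0 := by
      refine hh.nondegenerate.1 l fun y => ?_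
      obtain ⟨a, ha, w, hw, rfl⟩ := Submodule.mem_sup.1
        (hW.sup_eq_top ▸ Submodule.mem_top : y ∈ L ⊔ W)
      have h1 : h l w = 0 := LinearMap.congr_fun hl ⟨w, hw⟩
      rw [map_add, h1, apply_eq_zero hh.symm hL l.2 ha, add_zero]
    exact Subtype.ext h0
  have hinj : Function.Injective f := by
    intro x y hxy
    exact sub_eq_zero.1 (hf0 _ (by rw [map_sub, hxy, sub_self]))
  have hsurj : Function.Surjective f := by
    let fR : L →ₗ[ℝ] (W →ₗ[ℂ] ℂ) :=
      { toFun := f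
        map_add' := f.map_add
        map_smul' := fun c x => by
          have := f.map_smulₛₗ (c : ℂ) x
          simpa using this }
    refine (LinearMap.injective_iff_surjective_of_finrank_eq_finrank (f := fR) ?_).1 hinj
    rw [finrank_real_of_complex, finrank_real_of_complex, ← hdW]
    congr 1
    exact (Subspace.dual_finrank_eq (K := ℂ) (V := W)).symm
  let F : L ≃ₛₗ[starRingEnd ℂ] (W →ₗ[ℂ] ℂ) := LinearEquiv.ofBijective f ⟨hinj, hsurj⟩
  let K : W →ₗ[ℂ] L := (-(1 / 2 : ℂ)) • (F.symm.toLinearMap.comp g)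
  have hK : ∀ x w : W, h (K x : S) w = -(1 / 2) * h x w := by
    intro x w
    have h1 : f (F.symm (g x)) = g x := F.apply_symm_apply (g x)
    have h2 : f (K x) = (-(1 / 2 : ℂ)) • g x := by
      change f ((-(1 / 2 : ℂ)) • F.symm (g x)) = _
      rw [f.map_smulₛₗ, h1, map_neg, map_div₀, map_one, Complex.conj_ofNat]
    exact LinearMap.congr_fun h2 w
  have hK' : ∀ x w : W, h (x : S) (K w) = -(1 / 2) * h x w := by
    intro x w
    rw [← hh.symm.eq, hK, map_mul, hh.symm.eq, map_neg, map_div₀, map_one, Complex.conj_ofNat]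
  let G : W →ₗ[ℂ] S := W.subtype + L.subtype.comp K
  have hG : ∀ w, G w = w + K w := fun w => rfl
  have hGL : ∀ w, G w ∈ L → w = 0 := by
    intro w hw
    have h1 : (w : S) ∈ L := by
      have := L.sub_mem hw (K w).2
      rwa [hG, add_sub_cancel_right] at this
    exact Subtype.ext (Submodule.disjoint_def.1 hW.disjoint _ h1 w.2)
  have hGinj : Function.Injective G := by
    refine (injective_iff_map_eq_zero G).2 fun w hw => hGL w ?_
    rw [hw]
    exact L.zero_mem
  refine ⟨⟨LinearMap.range G, ?_, ?_⟩, ?_, ?_⟩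
  · rw [LinearMap.finrank_range_of_inj hGinj, hdW, hd]
  · rintro _ ⟨w, rfl⟩
    rw [realForm, hG, map_add h, LinearMap.add_apply, map_add, map_add, hK, hK',
      apply_eq_zero hh.symm hL (K w).2 (K w).2]
    ring_nf
    simp
  · refine Submodule.disjoint_def.2 ?_
    rintro _ hx ⟨w, rfl⟩
    rw [hGL w hx, map_zero]
  · refine codisjoint_iff.2 (eq_top_iff.2 fun y _ => ?_)
    obtain ⟨a, ha, w, hw, rfl⟩ := Submodule.mem_sup.1
      (hW.sup_eq_top ▸ Submodule.mem_top : y ∈ L ⊔ W)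
    refine Submodule.mem_sup.2 ⟨a - K ⟨w, hw⟩, L.sub_mem ha (K ⟨w, hw⟩).2, G ⟨w, hw⟩,
      ⟨_, rfl⟩, ?_⟩
    rw [hG]
    abel

/-- A chosen superlagrangian complement of `P`. -/
def complement (P : UManifold h) : UManifold h :=
  @Classical.epsilon _ ⟨P⟩ fun P₁ => Compl P P₁

theorem compl_complement [FiniteDimensional ℂ S] (hh : IsSuperhermitian h) (P : UManifold h) :
    Compl P (complement P) :=
  @Classical.epsilon_spec _ (fun P₁ => Compl P P₁) (exists_compl hh P)

/-- The Hermitian form `Q(p(t₀), p'(t₀))` on `p(t₀)`: the derivative at `t₀` of the path read in a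
chart `φ_{p(t₀),P₁}` with `P₁` complementary to `p(t₀)`. It is independent of the choice
of `P₁`. -/
def tangentForm (p : ℝ → UManifold h) (t₀ : ℝ) (v : (p t₀).1) : ℝ :=
  deriv (fun t => chart (p t₀) (complement (p t₀)) (p t) v) t₀

/-- The crossing form `Γ(p, P₀, t₀)`: the restriction of `Q(p(t₀), p'(t₀))` to `p(t₀) ∩ P₀`. -/
def crossingForm (p : ℝ → UManifold h) (P₀ : UManifold h) (t₀ : ℝ)
    (v : ((p t₀).1 ⊓ P₀.1 : Submodule ℂ S)) : ℝ :=
  tangentForm p t₀ ⟨v, v.2.1⟩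

/-- All crossings of the path with `𝒮(P₀)` on `[a, b]` are regular. -/
def HasOnlyRegularCrossings (P₀ : UManifold h) (a b : ℝ) (p : ℝ → UManifold h) : Prop :=
  ∀ t ∈ Icc a b, p t ∈ variety P₀ → IsNonsingular (crossingForm p P₀ t)

/-- The axioms of the Edwards-Maslov index relative to `P₀`. Here `μ a b p` is the index of the path
`p : [a, b] → 𝒰`; the axioms concern the continuous paths whose endpoints are not in `𝒮(P₀)`. -/
structure IsEMIndex (P₀ : UManifold h) (μ : ℝ → ℝ → (ℝ → UManifold h) → ℤ) : Prop where
  /-- Invariance under homotopies which keep the endpoints outside `𝒮(P₀)`. -/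
  homotopy : ∀ a b : ℝ, a < b → ∀ (H : ℝ → ℝ → UManifold h) (p₀ p₁ : ℝ → UManifold h),
    ContinuousOn (fun x : ℝ × ℝ => H x.1 x.2) (Icc 0 1 ×ˢ Icc a b) →
    (∀ s ∈ Icc (0 : ℝ) 1, IsAdmissible P₀ a b (H s)) →
    (∀ t ∈ Icc a b, H 0 t = p₀ t) → (∀ t ∈ Icc a b, H 1 t = p₁ t) →
    μ a b p₀ = μ a b p₁
  /-- Catenation. -/
  catenation : ∀ a c b : ℝ, a < c → c < b → ∀ p : ℝ → UManifold h,
    ContinuousOn p (Icc a b) → IsAdmissible P₀ a b p → p c ∉ variety P₀ →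
    μ a b p = μ a c p + μ c b p
  /-- Localization: for a path of graphs of Hermitian maps `H(t) : P₀ → P₁`, with `P₁` complementary
  to `P₀`, which has no crossing except possibly a regular one at `t₀`, the index is
  `½ sign H(t₀ + ε) - ½ sign H(t₀ - ε)`. -/
  localization : ∀ P₁ : UManifold h, Compl P₀ P₁ → ∀ a b t₀ : ℝ, t₀ ∈ Ioo a b →
    ∀ p : ℝ → UManifold h, IsDifferentiablePath a b p → IsAdmissible P₀ a b p →
    (∀ t ∈ Icc a b, Compl (p t) P₁) →
    (∀ t ∈ Icc a b, p t ∈ variety P₀ → t = t₀) → HasOnlyRegularCrossings P₀ a b p →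
    ∀ ε : ℝ, 0 < ε → a ≤ t₀ - ε → t₀ + ε ≤ b →
    2 * μ a b p = sign (chart P₀ P₁ (p (t₀ + ε))) - sign (chart P₀ P₁ (p (t₀ - ε)))

/-- The Edwards-Maslov index relative to `P₀`: the map singled out by its axioms. -/
def emIndex (P₀ : UManifold h) : ℝ → ℝ → (ℝ → UManifold h) → ℤ :=
  Classical.epsilon (IsEMIndex P₀)

end EMIndex

end

/-! Existence rests on a winding number. Complete a basis `e` of `P₀` to a Darboux basis `e, f` of
`S`. A superlagrangian `Q` with frame `v` is described by the matrices X = `gram h f v` and Y =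
`gram h e v`, and isotropy of `Q` reads X*Y + Y*X = 0. Hence X + Y and X − Y are invertible, and
det(X + Y)/det(X − Y) (`unitaryDet`) is a continuous nowhere zero function of `Q`, independent of
the frame. Along a path its logarithm has a well-defined increment, which has to be corrected at the
endpoints to become an integer. If `Q` is complementary to `P₀`, then R = −iXY⁻¹ is Hermitian and
the function equals (−1)ⁿ exp(iφ) with φ = 2 tr arctan R (`phase`). So the increment minus i times
the change of φ lies in 2πiℤ; the resulting integer is homotopy invariant and additive. In a chart
with complement `P₁` one may take X = 1 and Y = iN, where the Hermitian matrix N is half the chart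
form. The logarithm is then 2i tr arctan N, while R = −N⁻¹ and arctan x + arctan(1/x) = ±π/2 give φ
= 2 tr arctan N − π sign N. The integer is therefore half the difference of the signatures at the
two ends (`two_mul_windingIndex`). Since it does not depend on `f` (`windingIndex_eq_of_darboux`),
the localization axiom holds for every `P₁`.

The formula holds for any map obeying the axioms. Near an instant t use a chart whose complement is
common to `P₀` and `p t` (`exists_common_compl`). There ker N(t) corresponds to `p t ∩ P₀`, and
N'(t) restricted to it is half the crossing form (`crossingForm_kerEquiv`). If this restriction is
nonsingular, then just after and just before t the matrix N is invertible with signature sign N(t) ±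
sign(N'(t) on ker N(t)) (`eventually_sign_jump`). So crossings are isolated, each contributes the
signature of its crossing form, and compactness with catenation gives the sum. -/

noncomputable section

namespace EMIndex

open Module Filter Topology Matrix

/-! ### Inertia indices of real-valued forms -/

section PosIndex

variable {V V' : Type*} [AddCommGroup V] [Module ℂ V] [AddCommGroup V'] [Module ℂ V']

theorem finrank_le_posIndex [FiniteDimensional ℂ V] {Q : V → ℝ} {W : Submodule ℂ V}
    (hW : ∀ w ∈ W, w ≠ 0 → 0 < Q w) : finrank ℂ W ≤ posIndex Q :=
  le_csSup ⟨finrank ℂ V, by rintro _ ⟨U, rfl, -⟩; exact U.finrank_le⟩ ⟨W, rfl, hW⟩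

theorem exists_finrank_eq_posIndex [FiniteDimensional ℂ V] (Q : V → ℝ) :
    ∃ W : Submodule ℂ V, finrank ℂ W = posIndex Q ∧ ∀ w ∈ W, w ≠ 0 → 0 < Q w :=
  Nat.sSup_mem (s := {k : ℕ | ∃ W : Submodule ℂ V, finrank ℂ W = k ∧ ∀ w ∈ W, w ≠ 0 → 0 < Q w})
    ⟨0, ⊥, by simp, by simp⟩
    ⟨finrank ℂ V, by rintro _ ⟨U, rfl, -⟩; exact U.finrank_le⟩

theorem posIndex_add_finrank_le [FiniteDimensional ℂ V] {Q : V → ℝ} {W : Submodule ℂ V}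
    (hW : ∀ w ∈ W, Q w ≤ 0) : posIndex Q + finrank ℂ W ≤ finrank ℂ V := by
  obtain ⟨U, hU, hpos⟩ := exists_finrank_eq_posIndex Q
  rw [← hU]
  refine Submodule.finrank_add_finrank_le_of_disjoint (Submodule.disjoint_def.2 fun x hx hx' => ?_)
  by_contra h0
  exact absurd (hpos x hx h0) (not_lt.2 (hW x hx'))

theorem posIndex_add_posIndex_neg_le [FiniteDimensional ℂ V] (Q : V → ℝ) :
    posIndex Q + posIndex (fun v => -Q v) ≤ finrank ℂ V := by
  obtain ⟨U, hU, hneg⟩ := exists_finrank_eq_posIndex (fun v => -Q v)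
  obtain ⟨W, hW, hpos⟩ := exists_finrank_eq_posIndex Q
  rw [← hU, ← hW]
  refine Submodule.finrank_add_finrank_le_of_disjoint (Submodule.disjoint_def.2 fun x hx hx' => ?_)
  by_contra h0
  have h1 := hpos x hx h0
  have h2 := hneg x hx' h0
  linarith

theorem posIndex_le_of_injective [FiniteDimensional ℂ V] [FiniteDimensional ℂ V'] {Q : V → ℝ}
    {Q' : V' → ℝ} (φ : V →ₗ[ℂ] V') (hφ : Function.Injective φ) (h : ∀ v, 0 < Q v → 0 < Q' (φ v)) :
    posIndex Q ≤ posIndex Q' := by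
  obtain ⟨U, hU, hpos⟩ := exists_finrank_eq_posIndex Q
  rw [← hU, (Submodule.equivMapOfInjective φ hφ U).finrank_eq]
  refine finrank_le_posIndex ?_
  rintro _ ⟨u, hu, rfl⟩ h0
  exact h u (hpos u hu (by rintro rfl; simp at h0))

/-- The sum of the images of two maximal positive subspaces is positive; positivity also forces the
sum map to be injective. Applied to a form and to its negative, this superadditivity becomes an
equality by counting dimensions. -/
theorem posIndex_add_posIndex_le {V₁ V₂ : Type*} [AddCommGroup V₁] [Module ℂ V₁]
    [FiniteDimensional ℂ V₁] [AddCommGroup V₂] [Module ℂ V₂] [FiniteDimensional ℂ V₂]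
    [FiniteDimensional ℂ V] {Q : V → ℝ} {Q₁ : V₁ → ℝ} {Q₂ : V₂ → ℝ} (φ₁ : V₁ →ₗ[ℂ] V)
    (φ₂ : V₂ →ₗ[ℂ] V) (h0 : Q 0 = 0) (h1 : Q₁ 0 = 0) (h2 : Q₂ 0 = 0)
    (h : ∀ u w, Q (φ₁ u + φ₂ w) = Q₁ u + Q₂ w) : posIndex Q₁ + posIndex Q₂ ≤ posIndex Q := by
  obtain ⟨U, hU, hUpos⟩ := exists_finrank_eq_posIndex Q₁
  obtain ⟨W, hW, hWpos⟩ := exists_finrank_eq_posIndex Q₂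
  let φ : (U × W) →ₗ[ℂ] V := LinearMap.coprod (φ₁ ∘ₗ U.subtype) (φ₂ ∘ₗ W.subtype)
  have hpos : ∀ x, x ≠ 0 → 0 < Q (φ x) := by
    intro x hx
    change 0 < Q (φ₁ x.1 + φ₂ x.2)
    rw [h]
    by_cases hx1 : x.1 = 0
    · have hx2 : x.2 ≠ 0 := fun hx2 => hx (Prod.ext hx1 hx2)
      have := hWpos _ x.2.2 (by simpa using hx2)
      simpa [hx1, h1] using this
    · have h3 := hUpos _ x.1.2 (by simpa using hx1)
      by_cases hx2 : x.2 = 0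
      · simpa [hx2, h2] using h3
      · have := hWpos _ x.2.2 (by simpa using hx2)
        linarith
  have hinj : Function.Injective φ := by
    refine (injective_iff_map_eq_zero φ).2 fun x hx => ?_
    by_contra hx0
    have := hpos x hx0
    rw [hx, h0] at this
    exact lt_irrefl _ this
  rw [← hU, ← hW, ← finrank_prod, ← LinearMap.finrank_range_of_inj hinj]
  refine finrank_le_posIndex ?_
  rintro _ ⟨x, rfl⟩ hx
  exact hpos x (by rintro rfl; simp at hx)

/-- The scale `c` serves to absorb the factor 2 between chart or crossing forms and their matrices.
-/
theorem posIndex_congr [FiniteDimensional ℂ V] [FiniteDimensional ℂ V'] {Q : V → ℝ}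
    {Q' : V' → ℝ} (e : V ≃ₗ[ℂ] V') {c : ℝ} (hc : 0 < c) (h : ∀ v, Q' (e v) = c * Q v) :
    posIndex Q' = posIndex Q := by
  refine le_antisymm (posIndex_le_of_injective e.symm.toLinearMap e.symm.injective fun v hv => ?_)
    (posIndex_le_of_injective e.toLinearMap e.injective fun v hv => ?_)
  · have := h (e.symm v)
    rw [e.apply_symm_apply] at this
    rw [this] at hv
    exact pos_of_mul_pos_right hv hc.le
  · change 0 < Q' (e v)
    rw [h]
    positivity

theorem sign_congr [FiniteDimensional ℂ V] [FiniteDimensional ℂ V'] {Q : V → ℝ}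
    {Q' : V' → ℝ} (e : V ≃ₗ[ℂ] V') {c : ℝ} (hc : 0 < c) (h : ∀ v, Q' (e v) = c * Q v) :
    sign Q' = sign Q := by
  rw [sign, sign, posIndex_congr e hc h,
    posIndex_congr e hc (Q := fun v => -Q v) (Q' := fun v => -Q' v) (by simp [h])]

theorem sign_neg (Q : V → ℝ) : sign (fun v => -Q v) = -sign Q := by
  simp [sign]

theorem posIndex_diagonal {n : Type*} [Fintype n] (l : n → ℝ) :
    posIndex (fun c : n → ℂ => ∑ i, l i * ‖c i‖ ^ 2) = Fintype.card {i // 0 < l i} := by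
  classical
  have ext_zero : ∀ (p : n → Prop) [DecidablePred p] (c : {i // p i} → ℂ) (i : n),
      Function.extend Subtype.val c 0 i = if hi : p i then c ⟨i, hi⟩ else 0 := by
    intro p _ c i
    split_ifs with hi
    · exact Subtype.val_injective.extend_apply c 0 ⟨i, hi⟩
    · rw [Function.extend_apply' _ _ _ (by simpa using hi)]
      rfl
  let E : ∀ p : n → Prop, ({i // p i} → ℂ) →ₗ[ℂ] (n → ℂ) := fun p =>
    { toFun := fun c => Function.extend Subtype.val c 0
      map_add' := fun c d => by
        ext i
        simp only [ext_zero, Pi.add_apply]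
        split_ifs <;> simp
      map_smul' := fun a c => by
        ext i
        simp only [ext_zero, Pi.smul_apply, RingHom.id_apply]
        split_ifs <;> simp }
  have hE : ∀ (p : n → Prop) (c : {i // p i} → ℂ) (i : n),
      E p c i = if hi : p i then c ⟨i, hi⟩ else 0 := fun p c i => ext_zero p c i
  have hinj : ∀ p, Function.Injective (E p) := by
    intro p c d hcd
    ext i
    have := congrFun hcd i
    simpa [hE, i.2] using this
  have hrank : ∀ p, finrank ℂ (LinearMap.range (E p)) = Fintype.card {i // p i} := by
    intro p
    rw [LinearMap.finrank_range_of_inj (hinj p), finrank_fintype_fun_eq_card]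
  refine le_antisymm ?_ ?_
  -- The upper bound tests against the coordinate subspace of the indices with `l i ≤ 0`, whose
  -- dimension is complementary.
  · have h1 := posIndex_add_finrank_le (Q := fun c : n → ℂ => ∑ i, l i * ‖c i‖ ^ 2)
      (W := LinearMap.range (E fun i => ¬ 0 < l i)) (by
        rintro _ ⟨c, rfl⟩
        refine Finset.sum_nonpos fun i _ => ?_
        rw [hE]
        by_cases hi : 0 < l i
        · simp [hi]
        · exact mul_nonpos_of_nonpos_of_nonneg (not_lt.1 hi) (by positivity))
    rw [hrank, finrank_fintype_fun_eq_card, Fintype.card_subtype_compl] at h1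
    have := Fintype.card_subtype_le (fun i => 0 < l i)
    omega
  · rw [← hrank]
    refine finrank_le_posIndex ?_
    rintro _ ⟨c, rfl⟩ h0
    refine Finset.sum_pos' (fun i _ => ?_) ?_
    · rw [hE]
      split_ifs with hi
      · positivity
      · simp
    · have : c ≠ 0 := by
        rintro rfl
        simp at h0
      obtain ⟨i, hi⟩ := Function.ne_iff.1 this
      refine ⟨i, Finset.mem_univ _, ?_⟩
      rw [hE, dif_pos i.2]
      have := i.2
      have : 0 < ‖c i‖ := norm_pos_iff.2 hi
      positivity

end PosIndex

/-! ### Signature and arctangent trace of Hermitian matrices -/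

section Matrices

variable {n : Type*} [Fintype n]

/-- The real-valued form `c ↦ c* M c` of a matrix. -/
def matForm (M : Matrix n n ℂ) (c : n → ℂ) : ℝ := (star c ⬝ᵥ M *ᵥ c).re

theorem matForm_neg (M : Matrix n n ℂ) (c : n → ℂ) : matForm (-M) c = -matForm M c := by
  simp [matForm, neg_mulVec]

theorem matForm_add (M N : Matrix n n ℂ) (c : n → ℂ) :
    matForm (M + N) c = matForm M c + matForm N c := by
  simp [matForm, add_mulVec]

theorem matForm_conj {m : Type*} [Fintype m] (M : Matrix n n ℂ) (E : Matrix n m ℂ) (c : m → ℂ) :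
    matForm (Eᴴ * M * E) c = matForm M (E *ᵥ c) := by
  simp [matForm, ← mulVec_mulVec, star_mulVec, dotProduct_mulVec, vecMul_vecMul]

/-- `IsNonsingular` is phrased by additivity of the form; this polarization converts it into
statements about `M *ᵥ v`. -/
theorem matForm_add_right {M : Matrix n n ℂ} (hM : M.IsHermitian) (v w : n → ℂ) :
    matForm M (v + w) = matForm M v + matForm M w + 2 * (star w ⬝ᵥ M *ᵥ v).re := by
  have h1 : star v ⬝ᵥ M *ᵥ w = star (star w ⬝ᵥ M *ᵥ v) := by
    rw [dotProduct_mulVec, ← star_star (star v ᵥ* M), star_vecMul, star_star, hM.eq,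
      ← star_dotProduct_star, star_star, dotProduct_comm]
  have h2 : (star v ⬝ᵥ M *ᵥ w).re = (star w ⬝ᵥ M *ᵥ v).re := by
    rw [h1]
    simp
  simp only [matForm, star_add, mulVec_add, add_dotProduct, dotProduct_add, Complex.add_re, h2]
  ring

variable [DecidableEq n]

theorem matForm_diagonal (l : n → ℝ) (c : n → ℂ) :
    matForm (diagonal fun i => (l i : ℂ)) c = ∑ i, l i * ‖c i‖ ^ 2 := by
  simp only [matForm, dotProduct, mulVec_diagonal, Complex.re_sum]
  refine Finset.sum_congr rfl fun i _ => ?_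
  simp only [Pi.star_apply, RCLike.star_def]
  rw [mul_left_comm, ← Complex.normSq_eq_conj_mul_self, ← Complex.ofReal_mul, Complex.ofReal_re,
    Complex.normSq_eq_norm_sq]

theorem sign_matForm_conj (M : Matrix n n ℂ) {E : Matrix n n ℂ} (hE : IsUnit E) :
    sign (matForm (Eᴴ * M * E)) = sign (matForm M) := by
  refine (sign_congr (LinearEquiv.ofBijective (Matrix.mulVecLin E) ?_) one_pos fun c => ?_).symm
  · exact ⟨mulVec_injective_of_isUnit hE, mulVec_surjective_iff_isUnit.2 hE⟩
  · rw [one_mul, matForm_conj]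
    rfl

theorem posIndex_matForm_conj (M : Matrix n n ℂ) {E : Matrix n n ℂ} (hE : IsUnit E) :
    posIndex (matForm (Eᴴ * M * E)) = posIndex (matForm M) := by
  refine (posIndex_congr (LinearEquiv.ofBijective (Matrix.mulVecLin E) ?_) one_pos fun c => ?_).symm
  · exact ⟨mulVec_injective_of_isUnit hE, mulVec_surjective_iff_isUnit.2 hE⟩
  · rw [one_mul, matForm_conj]
    rfl

theorem eigenvectorUnitary_conj {M : Matrix n n ℂ} (hM : M.IsHermitian) :
    (hM.eigenvectorUnitary : Matrix n n ℂ) * (diagonal fun i => (hM.eigenvalues i : ℂ)) *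
      (hM.eigenvectorUnitary : Matrix n n ℂ)ᴴ = M := by
  conv_rhs => rw [hM.spectral_theorem]
  rfl

theorem isUnit_eigenvectorUnitary {M : Matrix n n ℂ} (hM : M.IsHermitian) :
    IsUnit (hM.eigenvectorUnitary : Matrix n n ℂ)ᴴ :=
  ⟨⟨(hM.eigenvectorUnitary : Matrix n n ℂ)ᴴ, hM.eigenvectorUnitary,
    Unitary.coe_star_mul_self hM.eigenvectorUnitary,
    Unitary.coe_mul_star_self hM.eigenvectorUnitary⟩, rfl⟩

theorem posIndex_matForm {M : Matrix n n ℂ} (hM : M.IsHermitian) :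
    posIndex (matForm M) = Fintype.card {i // 0 < hM.eigenvalues i} := by
  conv_lhs => rw [← eigenvectorUnitary_conj hM]
  have := posIndex_matForm_conj (diagonal fun i => (hM.eigenvalues i : ℂ))
    (isUnit_eigenvectorUnitary hM)
  rw [conjTranspose_conjTranspose] at this
  rw [this, ← posIndex_diagonal]
  congr 1
  ext c
  exact matForm_diagonal _ _

theorem posIndex_neg_matForm {M : Matrix n n ℂ} (hM : M.IsHermitian) :
    posIndex (fun c => -matForm M c) = Fintype.card {i // hM.eigenvalues i < 0} := by
  conv_lhs => rw [← eigenvectorUnitary_conj hM]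
  have := posIndex_matForm_conj (-diagonal fun i => (hM.eigenvalues i : ℂ))
    (isUnit_eigenvectorUnitary hM)
  rw [conjTranspose_conjTranspose] at this
  simp only [mul_neg, neg_mul] at this
  have h2 := posIndex_diagonal (fun i => -hM.eigenvalues i)
  simp only [Left.neg_pos_iff] at h2
  rw [← h2]
  refine Eq.trans ?_ (this.trans ?_)
  · congr 1
    ext c
    rw [matForm_neg]
  · congr 1
    ext c
    rw [matForm_neg, matForm_diagonal]
    simp

theorem sign_matForm {M : Matrix n n ℂ} (hM : M.IsHermitian) :
    (sign (matForm M) : ℝ) = ∑ i, Real.sign (hM.eigenvalues i) := by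
  have h1 : ∀ i, Real.sign (hM.eigenvalues i) =
      (if 0 < hM.eigenvalues i then 1 else 0) - (if hM.eigenvalues i < 0 then 1 else 0) := by
    intro i
    rcases lt_trichotomy (hM.eigenvalues i) 0 with h | h | h
    · simp [Real.sign_of_neg h, h, h.not_gt]
    · simp [h]
    · simp [Real.sign_of_pos h, h, h.not_gt]
  rw [sign, posIndex_matForm hM, posIndex_neg_matForm hM]
  simp only [h1, Finset.sum_sub_distrib, Finset.sum_boole, Fintype.card_subtype]
  push_cast
  rfl

theorem posIndex_add_posIndex_neg_matForm {M : Matrix n n ℂ} (hM : M.IsHermitian) :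
    posIndex (matForm M) + posIndex (fun c => -matForm M c) = M.rank := by
  rw [posIndex_matForm hM, posIndex_neg_matForm hM, hM.rank_eq_card_non_zero_eigs]
  simp only [Fintype.card_subtype]
  rw [← Finset.card_union_of_disjoint]
  · congr 1
    ext i
    simp only [Finset.mem_union, Finset.mem_filter, Finset.mem_univ, true_and]
    constructor
    · rintro (h | h)
      · exact h.ne'
      · exact h.ne
    · intro h
      exact h.lt_or_gt.symm
  · refine Finset.disjoint_filter.2 fun i _ h => not_lt.2 h.le

/-- The sum of the arcus tangents of the eigenvalues of a Hermitian matrix. -/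
def arctanTrace (M : Matrix n n ℂ) : ℝ := (cfc Real.arctan M).trace.re

theorem trace_cfc {M : Matrix n n ℂ} (hM : M.IsHermitian) (f : ℝ → ℝ) :
    (cfc f M).trace.re = ∑ i, f (hM.eigenvalues i) := by
  rw [hM.cfc_eq, IsHermitian.cfc, Unitary.conjStarAlgAut_apply, trace_mul_comm, ← mul_assoc,
    Unitary.coe_star_mul_self, one_mul, trace_diagonal]
  simp

theorem arctanTrace_eq {M : Matrix n n ℂ} (hM : M.IsHermitian) :
    arctanTrace M = ∑ i, Real.arctan (hM.eigenvalues i) :=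
  trace_cfc hM _

/-- On each eigenvalue, arctan x + arctan(1/x) is π/2 times the sign of x. This expresses the
discrete signature through continuous functions of the matrix. -/
theorem arctanTrace_add_arctanTrace_inv {M : Matrix n n ℂ} (hM : M.IsHermitian) (hu : IsUnit M) :
    arctanTrace M + arctanTrace M⁻¹ = Real.pi / 2 * sign (matForm M) := by
  have h0 : ∀ i, hM.eigenvalues i ≠ 0 := by
    intro i hi
    have := (isUnit_iff_isUnit_det M).1 hu
    rw [hM.det_eq_prod_eigenvalues] at this
    exact this.ne_zero (Finset.prod_eq_zero (Finset.mem_univ i) (by simp [hi]))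
  have h1 : M⁻¹ = cfc (fun x : ℝ => x⁻¹) M := by
    have := cfc_inv_id (R := ℝ) (hu.unit) (ha := hM)
    rw [IsUnit.unit_spec] at this
    rw [this, ← Ring.inverse_unit, IsUnit.unit_spec, nonsing_inv_eq_ringInverse]
  -- Finiteness of the spectrum makes `x⁻¹` continuous on it, as the composition rule for the
  -- functional calculus requires.
  have hfin : (spectrum ℝ M).Finite := Matrix.finite_real_spectrum
  have h2 : arctanTrace M⁻¹ = (cfc (fun x => Real.arctan x⁻¹) M).trace.re := by
    rw [arctanTrace, h1]
    congr 2
    exact (cfc_comp' Real.arctan (fun x => x⁻¹) M (Real.continuous_arctan.continuousOn)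
      (hfin.continuousOn _) hM).symm
  rw [h2, trace_cfc hM, arctanTrace_eq hM, sign_matForm hM, Finset.mul_sum,
    ← Finset.sum_add_distrib]
  refine Finset.sum_congr rfl fun i _ => ?_
  rcases (h0 i).lt_or_gt with h | h
  · rw [Real.arctan_inv_of_neg h, Real.sign_of_neg h]
    ring
  · rw [Real.arctan_inv_of_pos h, Real.sign_of_pos h]
    ring

/-- The functional calculus of a continuous function is continuous on self-adjoint matrices, so no
continuous labelling of the eigenvalues is needed. -/
theorem tendsto_arctanTrace {ι : Type*} {F : Filter ι} {M : ι → Matrix n n ℂ} {M₀ : Matrix n n ℂ}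
    (hM : ∀ᶠ x in F, (M x).IsHermitian) (hM₀ : M₀.IsHermitian) (h : Tendsto M F (𝓝 M₀)) :
    Tendsto (fun x => arctanTrace (M x)) F (𝓝 (arctanTrace M₀)) := by
  open scoped Matrix.Norms.L2Operator in
  have hcont : ContinuousOn (fun A : Matrix n n ℂ => cfc Real.arctan A) {A | IsSelfAdjoint A} :=
    ContinuousOn.cfc_of_mem_nhdsSet (s := univ) Real.arctan (by simp) continuousOn_id
      (fun x hx => hx) Real.continuous_arctan.continuousOn
  have h1 : Tendsto M F (𝓝[{A | IsSelfAdjoint A}] M₀) :=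
    tendsto_nhdsWithin_iff.2 ⟨h, hM⟩
  have h2 := (hcont M₀ hM₀).tendsto.comp h1
  exact ((Complex.continuous_re.comp continuous_id.matrix_trace).tendsto _).comp h2

theorem det_one_add_smul {M : Matrix n n ℂ} (hM : M.IsHermitian) (z : ℂ) :
    (1 + z • M).det = ∏ i, (1 + z * hM.eigenvalues i) := by
  have hU := Unitary.coe_mul_star_self hM.eigenvectorUnitary
  have hU' := Unitary.coe_star_mul_self hM.eigenvectorUnitary
  have : 1 + z • M = (hM.eigenvectorUnitary : Matrix n n ℂ) *
      (1 + z • diagonal fun i => (hM.eigenvalues i : ℂ)) *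
      (hM.eigenvectorUnitary : Matrix n n ℂ)ᴴ := by
    rw [mul_add, add_mul, mul_one, Matrix.mul_smul, Matrix.smul_mul, eigenvectorUnitary_conj hM]
    congr 1
    exact hU.symm
  have h1 : (hM.eigenvectorUnitary : Matrix n n ℂ)ᴴ * hM.eigenvectorUnitary = 1 := hU'
  rw [this, det_mul_comm, ← mul_assoc, h1, one_mul, ← diagonal_one, ← diagonal_smul, diagonal_add,
    det_diagonal]
  simp

/-- The conjugate numbers 1 ± ix have arguments ± arctan x. -/
theorem one_add_I_mul_eq (x : ℝ) :
    1 + Complex.I * x = (1 - Complex.I * x) * Complex.exp (2 * Complex.I * Real.arctan x) := by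
  have hc : Real.cos (Real.arctan x) ≠ 0 := (Real.cos_arctan_pos x).ne'
  have ht : Real.sin (Real.arctan x) = x * Real.cos (Real.arctan x) := by
    rw [← Real.tan_mul_cos hc, Real.tan_arctan]
  have h1 := Real.sin_sq_add_cos_sq (Real.arctan x)
  have : (2 * Complex.I * Real.arctan x : ℂ) = (Real.arctan x * Complex.I) + (Real.arctan x * Complex.I) := by ring
  rw [this, Complex.exp_add, Complex.exp_mul_I, ← Complex.ofReal_cos, ← Complex.ofReal_sin, ht]
  rw [ht] at h1
  have h2 : ((x : ℂ) * Real.cos (Real.arctan x)) ^ 2 + (Real.cos (Real.arctan x) : ℂ) ^ 2 = 1 := by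
    exact_mod_cast h1
  rw [Complex.ofReal_mul]
  generalize (Real.cos (Real.arctan x) : ℂ) = c at *
  linear_combination (-(1 + Complex.I * x)) * h2 + (1 + Complex.I * x) * c ^ 2 * x ^ 2 * Complex.I_sq

theorem det_one_add_I_smul {M : Matrix n n ℂ} (hM : M.IsHermitian) :
    (1 + Complex.I • M).det =
      (1 - Complex.I • M).det * Complex.exp (2 * Complex.I * arctanTrace M) := by
  rw [det_one_add_smul hM, sub_eq_add_neg, ← neg_smul, det_one_add_smul hM, arctanTrace_eq hM,
    Complex.ofReal_sum, Finset.mul_sum, Complex.exp_sum, ← Finset.prod_mul_distrib]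
  refine Finset.prod_congr rfl fun i _ => ?_
  rw [one_add_I_mul_eq, neg_mul, ← sub_eq_add_neg]

end Matrices

/-! ### Jump of the signature at a degenerate matrix -/

section Jump

variable {n : Type*} [Fintype n]

/-- In a basis of `K` the restricted form becomes a Hermitian matrix with trivial kernel, hence of
full rank. -/
theorem posIndex_add_posIndex_neg_of_isNonsingular {M : Matrix n n ℂ} (hM : M.IsHermitian)
    {K : Submodule ℂ (n → ℂ)} (hK : IsNonsingular fun k : K => matForm M k) :
    posIndex (fun k : K => matForm M k) + posIndex (fun k : K => -matForm M k) = finrank ℂ K := by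
  let b := Module.finBasis ℂ K
  let L : Matrix n (Fin (finrank ℂ K)) ℂ := Matrix.of fun i j => (b j : n → ℂ) i
  have hL : ∀ c, L *ᵥ c = (b.equivFun.symm c : K) := by
    intro c
    rw [Basis.equivFun_symm_apply, Submodule.coe_sum]
    ext i
    simp [mulVec, dotProduct, L, mul_comm]
  have hN : (Lᴴ * M * L).IsHermitian := isHermitian_conjTranspose_mul_mul L hM
  have h1 : ∀ c, matForm M (b.equivFun.symm c : K) = 1 * matForm (Lᴴ * M * L) c := by
    intro c
    rw [one_mul, matForm_conj M L, hL]
  have h2 : ∀ c, -matForm M (b.equivFun.symm c : K) = 1 * -matForm (Lᴴ * M * L) c := by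
    intro c
    rw [h1, one_mul, one_mul]
  rw [posIndex_congr b.equivFun.symm one_pos h1, posIndex_congr b.equivFun.symm one_pos h2,
    posIndex_add_posIndex_neg_matForm hN]
  have hunit : IsUnit (Lᴴ * M * L) := by
    rw [← mulVec_injective_iff_isUnit]
    refine (injective_iff_map_eq_zero (mulVecLin (Lᴴ * M * L))).2 fun c hc => ?_
    have hc' : (Lᴴ * M * L) *ᵥ c = 0 := hc
    refine b.equivFun.symm.map_eq_zero_iff.1 (hK _ fun w => ?_)
    obtain ⟨d, rfl⟩ := b.equivFun.symm.surjective w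
    rw [← map_add]
    change matForm M _ = matForm M _ + matForm M _
    rw [h1, h1, h1, matForm_add_right hN, hc']
    simp [matForm, hc']
  rw [rank_of_isUnit _ hunit, Fintype.card_fin]

variable [DecidableEq n]

theorem tendsto_matrix_inv {ι : Type*} {F : Filter ι} {M : ι → Matrix n n ℂ} {M₀ : Matrix n n ℂ}
    (hu : IsUnit M₀) (h : Tendsto M F (𝓝 M₀)) : Tendsto (fun x => (M x)⁻¹) F (𝓝 M₀⁻¹) := by
  have hd : M₀.det ≠ 0 := ((isUnit_iff_isUnit_det M₀).1 hu).ne_zero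
  have h1 : Tendsto (fun x => (M x).det) F (𝓝 M₀.det) :=
    ((continuous_id.matrix_det).tendsto M₀).comp h
  have h2 : Tendsto (fun x => (M x).adjugate) F (𝓝 M₀.adjugate) :=
    ((continuous_id.matrix_adjugate).tendsto M₀).comp h
  simp only [inv_def, Ring.inverse_eq_inv']
  exact (h1.inv₀ hd).smul h2

theorem eventually_isUnit {ι : Type*} {F : Filter ι} {M : ι → Matrix n n ℂ} {M₀ : Matrix n n ℂ}
    (hu : IsUnit M₀) (h : Tendsto M F (𝓝 M₀)) : ∀ᶠ x in F, IsUnit (M x) := by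
  have hd : M₀.det ≠ 0 := ((isUnit_iff_isUnit_det M₀).1 hu).ne_zero
  have h1 : Tendsto (fun x => (M x).det) F (𝓝 M₀.det) :=
    ((continuous_id.matrix_det).tendsto M₀).comp h
  filter_upwards [h1.eventually_ne hd] with x hx
  exact (isUnit_iff_isUnit_det _).2 (isUnit_iff_ne_zero.2 hx)

/-- `arctanTrace M + arctanTrace M⁻¹` is continuous at an invertible Hermitian matrix and takes
values in (π/2)ℤ, so the signature is locally constant there. -/
theorem eventually_sign_eq {ι : Type*} {F : Filter ι} {M : ι → Matrix n n ℂ} {M₀ : Matrix n n ℂ}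
    (hM : ∀ᶠ x in F, (M x).IsHermitian) (hM₀ : M₀.IsHermitian) (hu : IsUnit M₀)
    (h : Tendsto M F (𝓝 M₀)) :
    ∀ᶠ x in F, IsUnit (M x) ∧ sign (matForm (M x)) = sign (matForm M₀) := by
  have h1 := tendsto_arctanTrace hM hM₀ h
  have h2 := tendsto_arctanTrace (hM.mono fun x hx => hx.inv) hM₀.inv (tendsto_matrix_inv hu h)
  -- Within distance π/2 the two integers differ by less than 1.
  have h3 := (h1.add h2).eventually (Metric.ball_mem_nhds _ (by positivity : (0 : ℝ) < Real.pi / 2))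
  filter_upwards [hM, eventually_isUnit hu h, h3] with x hx hux h4
  refine ⟨hux, ?_⟩
  rw [Real.dist_eq, arctanTrace_add_arctanTrace_inv hx hux,
    arctanTrace_add_arctanTrace_inv hM₀ hu, ← mul_sub, abs_mul,
    abs_of_pos (by positivity : (0 : ℝ) < Real.pi / 2)] at h4
  have h5 : |((sign (matForm (M x)) : ℝ) - sign (matForm M₀))| < 1 := by
    by_contra hcon
    have : (0 : ℝ) < Real.pi / 2 := by positivity
    nlinarith
  have h6 : |sign (matForm (M x)) - sign (matForm M₀)| < 1 := by exact_mod_cast h5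
  rw [Int.abs_lt_one_iff] at h6
  omega

/-- With `P` a projection onto ker A, the form is the orthogonal sum of A on ker P, where A loses
only its radical, and of M on ker A. -/
theorem sign_add_of_ker {A M P : Matrix n n ℂ} {K : Submodule ℂ (n → ℂ)}
    (hKA : K = LinearMap.ker A.mulVecLin) (hA : A.IsHermitian) (hM : M.IsHermitian)
    (hP : ∀ v, P *ᵥ v ∈ K)
    (hP' : ∀ v ∈ K, P *ᵥ v = v)
    (hK : IsNonsingular fun k : K => matForm M k) :
    IsUnit (A + Pᴴ * M * P) ∧ sign (matForm (A + Pᴴ * M * P)) =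
      sign (matForm A) + sign fun k : K => matForm M k := by
  have hmem : ∀ v, v ∈ K ↔ A *ᵥ v = 0 := fun v => by rw [hKA]; rfl
  have hform : ∀ v, matForm (A + Pᴴ * M * P) v = matForm A v + matForm M (P *ᵥ v) := by
    intro v
    rw [matForm_add, matForm_conj]
  have hAk : ∀ v, ∀ k ∈ K, matForm A (v + k) = matForm A v := by
    intro v k hk
    have hk' : A *ᵥ k = 0 := (hmem k).1 hk
    rw [add_comm, matForm_add_right hA, hk']
    simp [matForm, hk']
  have hunit : IsUnit (A + Pᴴ * M * P) := by
    rw [← mulVec_injective_iff_isUnit]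
    refine (injective_iff_map_eq_zero (mulVecLin (A + Pᴴ * M * P))).2 fun c hc => ?_
    have hc' : A *ᵥ c + Pᴴ *ᵥ (M *ᵥ (P *ᵥ c)) = 0 := by
      have : (A + Pᴴ * M * P) *ᵥ c = 0 := hc
      simpa [add_mulVec, ← mulVec_mulVec] using this
    have h1 : (⟨P *ᵥ c, hP c⟩ : K) = 0 := by
      refine hK _ fun w => ?_
      have h2 : star (w : n → ℂ) ⬝ᵥ M *ᵥ (P *ᵥ c) = 0 := by
        have h3 : star (w : n → ℂ) ⬝ᵥ (A *ᵥ c + Pᴴ *ᵥ (M *ᵥ (P *ᵥ c))) = 0 := by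
          rw [hc', dotProduct_zero]
        have h4 : star (w : n → ℂ) ⬝ᵥ A *ᵥ c = 0 := by
          have h5 : A *ᵥ (w : n → ℂ) = 0 := (hmem _).1 w.2
          rw [dotProduct_mulVec, ← hA.eq, ← star_mulVec, h5]
          simp
        rw [dotProduct_add, h4, zero_add, dotProduct_mulVec, ← star_mulVec, hP' _ w.2] at h3
        exact h3
      change matForm M (P *ᵥ c + w) = _
      rw [matForm_add_right hM, h2]
      simp
    have h2 : P *ᵥ c = 0 := congrArg Subtype.val h1
    have h3 : c ∈ K := by
      rw [hmem]
      simpa [h2] using hc'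
    rw [← hP' c h3, h2]
  refine ⟨hunit, ?_⟩
  -- `P` sends `(1 - P) u + k` to `k`, while `A` does not see the components in `K`.
  have hval : ∀ (u : n → ℂ) (k : K), matForm (A + Pᴴ * M * P) ((1 - P).mulVecLin u + K.subtype k) =
      matForm A u + matForm M k := by
    intro u k
    change matForm _ ((1 - P) *ᵥ u + (k : n → ℂ)) = _
    have e1 : P *ᵥ ((1 - P) *ᵥ u + (k : n → ℂ)) = k := by
      rw [mulVec_add, hP' _ k.2, sub_mulVec, one_mulVec, mulVec_sub, hP' _ (hP _),
        sub_self, zero_add]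
    have e2 : (1 - P) *ᵥ u + (k : n → ℂ) = u + ((k : n → ℂ) - P *ᵥ u) := by
      rw [sub_mulVec, one_mulVec]
      abel
    rw [hform, e1, e2, hAk _ _ (K.sub_mem k.2 (hP _))]
  have k1 : posIndex (matForm A) + posIndex (fun k : K => matForm M k) ≤
      posIndex (matForm (A + Pᴴ * M * P)) :=
    posIndex_add_posIndex_le _ _ (by simp [matForm]) (by simp [matForm]) (by simp [matForm]) hval
  have k2 : posIndex (fun c => -matForm A c) + posIndex (fun k : K => -matForm M k) ≤
      posIndex (fun c => -matForm (A + Pᴴ * M * P) c) :=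
    posIndex_add_posIndex_le _ _ (by simp [matForm]) (by simp [matForm]) (by simp [matForm])
      fun u k => by rw [hval, neg_add]
  have t1 := posIndex_add_posIndex_neg_le (matForm (A + Pᴴ * M * P))
  have t2 := posIndex_add_posIndex_neg_matForm hA
  have t3 := posIndex_add_posIndex_neg_of_isNonsingular hM hK
  have t4 : A.rank + finrank ℂ K = finrank ℂ (n → ℂ) := by
    rw [hKA]
    exact LinearMap.finrank_range_add_finrank_ker _
  -- The lower bounds `k1` and `k2` add up to rank A + dim ker A, the whole dimension, which is also
  -- an upper bound by `t1`; both are therefore equalities.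
  simp only [sign]
  omega

/-- Stretch the kernel of `A` by s^(−1/2): with E = (1 − P) + s^(−1/2) P, the congruent matrix E*(A
+ sB)E equals A + L*BL for L = √s (1 − P) + P. It converges to A + P*MP, which is invertible, so its
signature is eventually that of the limit. Congruence changes neither signature nor invertibility.
-/
theorem eventually_sign_jump {A M : Matrix n n ℂ} {B : ℝ → Matrix n n ℂ} (hA : A.IsHermitian)
    (hM : M.IsHermitian) (hB : ∀ᶠ s in 𝓝[>] (0 : ℝ), (B s).IsHermitian)
    (hBM : Tendsto B (𝓝[>] 0) (𝓝 M))
    (hK : IsNonsingular fun k : LinearMap.ker A.mulVecLin => matForm M k) :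
    ∀ᶠ s : ℝ in 𝓝[>] 0, IsUnit (A + s • B s) ∧ sign (matForm (A + s • B s)) =
      sign (matForm A) + sign fun k : LinearMap.ker A.mulVecLin => matForm M k := by
  obtain ⟨W, hW⟩ := (LinearMap.ker A.mulVecLin).exists_isCompl
  obtain ⟨P, hPdef⟩ : ∃ P : Matrix n n ℂ, ∀ v, P *ᵥ v = (LinearMap.ker A.mulVecLin).projection W hW v :=
    ⟨LinearMap.toMatrix' ((LinearMap.ker A.mulVecLin).projection W hW),
      fun v => LinearMap.toMatrix'_mulVec _ v⟩
  have hP : ∀ v, P *ᵥ v ∈ LinearMap.ker A.mulVecLin := fun v => by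
    rw [hPdef]
    exact Submodule.projection_apply_mem hW v
  have hP' : ∀ v ∈ LinearMap.ker A.mulVecLin, P *ᵥ v = v := fun v hv => by
    rw [hPdef]
    exact Submodule.projection_apply_of_mem_left hW hv
  obtain ⟨hu, hs⟩ := sign_add_of_ker rfl hA hM hP hP' hK
  have hAP : A * P = 0 := by
    refine Matrix.ext_of_mulVec_single fun i => ?_
    rw [← mulVec_mulVec, zero_mulVec]
    exact hP _
  have hPP : P * P = P := by
    refine Matrix.ext_of_mulVec_single fun i => ?_
    rw [← mulVec_mulVec]
    exact hP' _ (hP _)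
  -- the rescaled family
  let L : ℝ → Matrix n n ℂ := fun s => (√s : ℂ) • (1 - P) + P
  let E : ℝ → Matrix n n ℂ := fun s => (1 - P) + ((√s)⁻¹ : ℂ) • P
  have hLcont : Tendsto L (𝓝[>] 0) (𝓝 P) := by
    have hc : Continuous L := by
      have : Continuous fun s : ℝ => (√s : ℂ) := Complex.continuous_ofReal.comp Real.continuous_sqrt
      exact (this.smul continuous_const).add continuous_const
    have := (hc.tendsto 0).mono_left (nhdsWithin_le_nhds (s := Ioi 0))
    simpa [L] using this
  have hE : ∀ s : ℝ, 0 < s → IsUnit (E s) := by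
    intro s hs
    have h0 : (√s : ℂ) ≠ 0 := by
      exact_mod_cast (Real.sqrt_pos.2 hs).ne'
    refine IsUnit.of_mul_eq_one ((1 - P) + (√s : ℂ) • P) ?_
    simp only [E, mul_add, add_mul, Matrix.mul_smul, Matrix.smul_mul, mul_sub, sub_mul, one_mul,
      mul_one, hPP, smul_smul, mul_inv_cancel₀ h0, sub_self, one_smul]
    simp
  have hEs : ∀ s : ℝ, 0 < s → (E s)ᴴ * (A + s • B s) * E s = A + (L s)ᴴ * B s * L s := by
    intro s hs
    have h0 : (√s : ℂ) ≠ 0 := by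
      exact_mod_cast (Real.sqrt_pos.2 hs).ne'
    have hL : L s = (√s : ℂ) • E s := by
      simp only [L, E, smul_add, smul_smul, mul_inv_cancel₀ h0, one_smul]
    have e1 : A * E s = A := by
      simp only [E, mul_add, Matrix.mul_smul, mul_sub, mul_one, hAP]
      simp
    have e2 : (E s)ᴴ * A = A := by
      rw [← conjTranspose_inj, conjTranspose_mul, conjTranspose_conjTranspose, hA.eq, e1]
    have e3 : (√s : ℂ) * (√s : ℂ) = s := by
      exact_mod_cast Real.mul_self_sqrt hs.le
    rw [hL, conjTranspose_smul, mul_add (E s)ᴴ, add_mul _ _ (E s), e2, e1]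
    congr 1
    simp only [Matrix.mul_smul, Matrix.smul_mul, smul_smul, RCLike.star_def, Complex.conj_ofReal, e3]
    ext i j
    simp
  have hlim : Tendsto (fun s => A + (L s)ᴴ * B s * L s) (𝓝[>] 0) (𝓝 (A + Pᴴ * M * P)) := by
    have h1 : Tendsto (fun s => (L s)ᴴ) (𝓝[>] 0) (𝓝 Pᴴ) :=
      ((continuous_id.matrix_conjTranspose).tendsto P).comp hLcont
    exact tendsto_const_nhds.add ((h1.mul hBM).mul hLcont)
  filter_upwards [eventually_sign_eq (hB.mono fun s h => hA.add
    (isHermitian_conjTranspose_mul_mul (L s) h)) (hA.add (isHermitian_conjTranspose_mul_mul P hM))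
    hu hlim, self_mem_nhdsWithin] with s h1 hs0
  rw [← hEs s hs0, sign_matForm_conj _ (hE s hs0), hs] at h1
  refine ⟨?_, h1.2⟩
  obtain ⟨u, hu'⟩ := hE s hs0
  have h2 : IsUnit (E s)ᴴ := by
    rw [← star_eq_conjTranspose]
    exact (hE s hs0).star
  have h3 : IsUnit ((E s)ᴴ * (A + s • B s)) := by
    have := h1.1
    rw [← hu'] at this ⊢
    exact (Units.isUnit_mul_units _ u).1 this
  obtain ⟨w, hw⟩ := h2
  rw [← hw] at h3
  exact (Units.isUnit_units_mul w _).1 h3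

end Jump

/-! ### Darboux bases, frames and common complements -/

section Darboux

variable {S : Type*} [AddCommGroup S] [Module ℂ S] {h : S →ₗ⋆[ℂ] S →ₗ[ℂ] ℂ} {n : ℕ}

/-- A pair of dual isotropic families which together form a basis of `S`. -/
structure IsDarboux (h : S →ₗ⋆[ℂ] S →ₗ[ℂ] ℂ) (e f : Fin n → S) : Prop where
  symm : h.IsSymm
  left : ∀ i j, h (e i) (e j) = 0
  right : ∀ i j, h (f i) (f j) = 0
  dual : ∀ i j, h (e i) (f j) = if i = j then 1 else 0
  card : n + n = finrank ℂ S

theorem IsDarboux.dual' {e f : Fin n → S} (H : IsDarboux h e f) (i j : Fin n) :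
    h (f i) (e j) = if i = j then 1 else 0 := by
  rw [← H.symm.eq, H.dual]
  simp [apply_ite, eq_comm]

theorem IsDarboux.swap {e f : Fin n → S} (H : IsDarboux h e f) : IsDarboux h f e :=
  ⟨H.symm, H.right, H.left, H.dual', H.card⟩

/-- Coefficients along `e` are read off by `f` and conversely, so the synthesis map is injective,
and bijective by dimension. -/
theorem IsDarboux.expansion [FiniteDimensional ℂ S] {e f : Fin n → S} (H : IsDarboux h e f) (v : S) :
    ∑ i, h (f i) v • e i + ∑ i, h (e i) v • f i = v := by
  let A : ((Fin n → ℂ) × (Fin n → ℂ)) →ₗ[ℂ] S :=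
    LinearMap.coprod (Fintype.linearCombination ℂ e) (Fintype.linearCombination ℂ f)
  have hA : ∀ x, A x = ∑ i, x.1 i • e i + ∑ i, x.2 i • f i := fun x => by
    simp [A, Fintype.linearCombination_apply]
  have hB : ∀ x, (fun i => h (f i) (A x), fun i => h (e i) (A x)) = x := by
    intro x
    ext i <;> simp [hA, H.left, H.right, H.dual, H.dual']
  have hinj : Function.Injective A := by
    intro x y hxy
    rw [← hB x, ← hB y, hxy]
  have hsurj : Function.Surjective A := by
    refine (LinearMap.injective_iff_surjective_of_finrank_eq_finrank ?_).1 hinj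
    rw [finrank_prod, finrank_fintype_fun_eq_card, Fintype.card_fin, H.card]
  obtain ⟨x, rfl⟩ := hsurj v
  conv_rhs => rw [← hB x, hA]

theorem IsDarboux.apply_eq [FiniteDimensional ℂ S] {e f : Fin n → S} (H : IsDarboux h e f)
    (v w : S) :
    h v w = ∑ i, (star (h (f i) v) * h (e i) w + star (h (e i) v) * h (f i) w) := by
  conv_lhs => rw [← H.expansion w]
  simp only [map_add, map_sum, map_smul, smul_eq_mul, Finset.sum_add_distrib]
  rw [add_comm]
  congr 1 <;>
  · refine Finset.sum_congr rfl fun i _ => ?_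
    rw [RCLike.star_def, H.symm.eq, mul_comm]

/-- The matrix of the values of the form on two families of vectors. -/
def gram (h : S →ₗ⋆[ℂ] S →ₗ[ℂ] ℂ) (e v : Fin n → S) : Matrix (Fin n) (Fin n) ℂ :=
  Matrix.of fun i j => h (e i) (v j)

theorem gram_mulVec (e v : Fin n → S) (c : Fin n → ℂ) (i : Fin n) :
    (gram h e v *ᵥ c) i = h (e i) (∑ j, c j • v j) := by
  simp [gram, mulVec, dotProduct, mul_comm]

theorem gram_mul (e v : Fin n → S) (G : Matrix (Fin n) (Fin n) ℂ) :
    gram h e (fun j => ∑ i, G i j • v i) = gram h e v * G := by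
  ext i j
  simp [gram, mul_apply, mul_comm]

theorem IsDarboux.gram_self [FiniteDimensional ℂ S] {e f : Fin n → S} (H : IsDarboux h e f)
    (v w : Fin n → S) :
    gram h v w = (gram h f v)ᴴ * gram h e w + (gram h e v)ᴴ * gram h f w := by
  ext i j
  simp only [gram, of_apply, Matrix.add_apply, mul_apply, conjTranspose_apply]
  rw [H.apply_eq, Finset.sum_add_distrib]

/-- A family of vectors which is a basis of the superlagrangian subspace `P`. -/
structure IsFrame (P : UManifold h) (v : Fin n → S) : Prop where
  mem : ∀ i, v i ∈ P.1
  indep : LinearIndependent ℂ v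
  card : n + n = finrank ℂ S

theorem IsFrame.span_eq [FiniteDimensional ℂ S] {P : UManifold h} {v : Fin n → S}
    (hv : IsFrame P v) : Submodule.span ℂ (range v) = P.1 := by
  refine Submodule.eq_of_le_of_finrank_eq (Submodule.span_le.2 ?_) ?_
  · rintro _ ⟨i, rfl⟩
    exact hv.mem i
  · rw [finrank_span_eq_card hv.indep, Fintype.card_fin]
    have := P.2.1
    have := hv.card
    omega

theorem IsFrame.exists_coord [FiniteDimensional ℂ S] {P : UManifold h} {v : Fin n → S}
    (hv : IsFrame P v) {x : S} (hx : x ∈ P.1) : ∃ c : Fin n → ℂ, x = ∑ i, c i • v i := by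
  rw [← hv.span_eq] at hx
  obtain ⟨c, hc⟩ := (Submodule.mem_span_range_iff_exists_fun ℂ).1 hx
  exact ⟨c, hc.symm⟩

theorem IsFrame.sum_eq_zero {P : UManifold h} {v : Fin n → S} (hv : IsFrame P v) {c : Fin n → ℂ}
    (hc : ∑ i, c i • v i = 0) : c = 0 :=
  funext (Fintype.linearIndependent_iff.1 hv.indep c hc)

theorem IsFrame.sum_mem {P : UManifold h} {v : Fin n → S} (hv : IsFrame P v) (c : Fin n → ℂ) :
    ∑ i, c i • v i ∈ P.1 :=
  P.1.sum_mem fun i _ => P.1.smul_mem _ (hv.mem i)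

/-- The coordinates on a superlagrangian subspace with respect to a frame. -/
def IsFrame.equiv [FiniteDimensional ℂ S] {P : UManifold h} {v : Fin n → S} (hv : IsFrame P v) :
    (Fin n → ℂ) ≃ₗ[ℂ] P.1 :=
  LinearEquiv.ofBijective ((Fintype.linearCombination ℂ v).codRestrict P.1 fun c => by
    rw [Fintype.linearCombination_apply]
    exact hv.sum_mem c)
    ⟨by
      refine (injective_iff_map_eq_zero _).2 fun c hc => hv.sum_eq_zero ?_
      have := congrArg Subtype.val hc
      rwa [LinearMap.codRestrict_apply, Fintype.linearCombination_apply] at this,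
    fun x => by
      obtain ⟨c, hc⟩ := hv.exists_coord x.2
      refine ⟨c, Subtype.ext ?_⟩
      rw [LinearMap.codRestrict_apply, Fintype.linearCombination_apply, hc]⟩

theorem IsFrame.equiv_apply [FiniteDimensional ℂ S] {P : UManifold h} {v : Fin n → S}
    (hv : IsFrame P v) (c : Fin n → ℂ) : (hv.equiv c : S) = ∑ i, c i • v i :=
  Fintype.linearCombination_apply ℂ v c

theorem exists_frame [FiniteDimensional ℂ S] (P : UManifold h) (hn : n + n = finrank ℂ S) :
    ∃ v : Fin n → S, IsFrame P v := by
  have hd : finrank ℂ P.1 = n := by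
    have := P.2.1
    omega
  let b := finBasisOfFinrankEq ℂ P.1 hd
  refine ⟨fun i => b i, fun i => (b i).2, ?_, hn⟩
  exact b.linearIndependent.map' P.1.subtype P.1.ker_subtype

theorem gram_isotropic (hs : h.IsSymm) {P : UManifold h} {v w : Fin n → S} (hv : ∀ i, v i ∈ P.1)
    (hw : ∀ i, w i ∈ P.1) : gram h v w = 0 := by
  ext i j
  exact apply_eq_zero hs P.2.2 (hv i) (hw j)

theorem IsDarboux.linearIndependent_left {e f : Fin n → S} (H : IsDarboux h e f) :
    LinearIndependent ℂ e := by
  refine Fintype.linearIndependent_iff.2 fun c hc i => ?_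
  have := congrArg (h (f i)) hc
  simpa [H.dual'] using this

/-- The superlagrangian subspace spanned by the first half of a Darboux basis. -/
def IsDarboux.leftSpan {e f : Fin n → S} (H : IsDarboux h e f) : UManifold h where
  val := Submodule.span ℂ (range e)
  property := by
    refine ⟨?_, fun v hv => ?_⟩
    · rw [finrank_span_eq_card H.linearIndependent_left, Fintype.card_fin, ← H.card, two_mul]
    · obtain ⟨c, rfl⟩ := (Submodule.mem_span_range_iff_exists_fun ℂ).1 hv
      simp [realForm, H.left]

theorem IsDarboux.isFrame_leftSpan {e f : Fin n → S} (H : IsDarboux h e f) :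
    IsFrame H.leftSpan e :=
  ⟨fun i => Submodule.subset_span ⟨i, rfl⟩, H.linearIndependent_left, H.card⟩

theorem compl_of_disjoint [FiniteDimensional ℂ S] {P Q : UManifold h} (hd : Disjoint P.1 Q.1) :
    Compl P Q := by
  refine (Submodule.isCompl_iff_disjoint _ _ ?_).2 hd
  have := P.2.1
  have := Q.2.1
  omega

theorem notMem_variety_iff [FiniteDimensional ℂ S] {P P₀ : UManifold h} :
    P ∉ variety P₀ ↔ Compl P P₀ := by
  simp only [variety, stratum, mem_iUnion, mem_ofPred_eq, exists_prop, not_exists, not_and,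
    Finset.mem_Icc]
  constructor
  · intro H
    refine compl_of_disjoint (disjoint_iff.2 (Submodule.finrank_eq_zero.1 ?_))
    by_contra h0
    refine H _ ⟨Nat.one_le_iff_ne_zero.2 h0, ?_⟩ rfl
    have h1 := Submodule.finrank_mono (inf_le_left : P.1 ⊓ P₀.1 ≤ P.1)
    have := P.2.1
    omega
  · rintro hc k ⟨hk, -⟩ h1
    rw [hc.inf_eq_bot, finrank_bot] at h1
    omega

/-- The frames `(X, Y)` of a superlagrangian subspace satisfy `det (X - z Y) ≠ 0` whenever
`Re z ≠ 0`. -/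
theorem IsDarboux.det_sub_smul_ne_zero [FiniteDimensional ℂ S] {e f : Fin n → S}
    (H : IsDarboux h e f) {P : UManifold h} {v : Fin n → S} (hv : IsFrame P v) {z : ℂ}
    (hz : z.re ≠ 0) : (gram h f v - z • gram h e v).det ≠ 0 := by
  intro h0
  obtain ⟨c, hc, hc0⟩ := exists_mulVec_eq_zero_iff.2 h0
  set w := ∑ j, c j • v j with hw
  have hxy : ∀ i, h (f i) w = z * h (e i) w := by
    intro i
    have := congrFun hc0 i
    rw [sub_mulVec, smul_mulVec, Pi.sub_apply, Pi.smul_apply, gram_mulVec, gram_mulVec] at this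
    exact sub_eq_zero.1 this
  have hww : h w w = 0 := apply_eq_zero H.symm P.2.2 (hv.sum_mem c) (hv.sum_mem c)
  -- A kernel vector gives `w` with X-coordinates z times its Y-coordinates y, so 0 = h(w, w) = 2 Re
  -- z · Σ|yᵢ|².
  have hsum : ∑ i, Complex.normSq (h (e i) w) = 0 := by
    rw [H.apply_eq] at hww
    have h1 : ∀ i, star (h (f i) w) * h (e i) w + star (h (e i) w) * h (f i) w =
        ((2 * z.re * Complex.normSq (h (e i) w) : ℝ) : ℂ) := by
      intro i
      rw [hxy, star_mul', RCLike.star_def]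
      push_cast
      have h2 := Complex.add_conj z
      push_cast at h2
      rw [Complex.normSq_eq_conj_mul_self, ← h2]
      ring
    simp only [h1, ← Complex.ofReal_sum, ← Finset.mul_sum, Complex.ofReal_eq_zero] at hww
    rcases mul_eq_zero.1 hww with h2 | h2
    · exact absurd h2 (by simpa using hz)
    · exact h2
  have hy : ∀ i, h (e i) w = 0 := fun i =>
    Complex.normSq_eq_zero.1
      ((Finset.sum_eq_zero_iff_of_nonneg fun i _ => Complex.normSq_nonneg _).1 hsum i
        (Finset.mem_univ i))
  have : w = 0 := by
    rw [← H.expansion w]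
    simp [hxy, hy]
  exact hc (hv.sum_eq_zero this)

/-- The vectors annihilated by all `h (e i)` are exactly those of `P₀`, so the kernel of Y
parametrizes `P ∩ P₀`. -/
theorem IsDarboux.isUnit_gram_iff [FiniteDimensional ℂ S] {e f : Fin n → S}
    (H : IsDarboux h e f) {P P₀ : UManifold h} (he : IsFrame P₀ e) {v : Fin n → S}
    (hv : IsFrame P v) : IsUnit (gram h e v) ↔ Compl P P₀ := by
  rw [isUnit_iff_isUnit_det, isUnit_iff_ne_zero, Ne, ← exists_mulVec_eq_zero_iff]
  constructor
  · intro h0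
    refine compl_of_disjoint (Submodule.disjoint_def.2 fun x hx hx0 => ?_)
    obtain ⟨c, rfl⟩ := hv.exists_coord hx
    by_contra hne
    refine h0 ⟨c, fun hc => hne (by simp [hc]), ?_⟩
    ext i
    rw [gram_mulVec, Pi.zero_apply]
    exact apply_eq_zero H.symm P₀.2.2 (he.mem i) hx0
  · rintro hc ⟨c, hc0, hc1⟩
    refine hc0 (hv.sum_eq_zero (Submodule.disjoint_def.1 hc.disjoint _ (hv.sum_mem c) ?_))
    rw [← H.expansion (∑ i, c i • v i)]
    have h1 : ∀ i, h (e i) (∑ i, c i • v i) = 0 := fun i => by rw [← gram_mulVec, hc1]; rfl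
    simp only [h1, zero_smul, Finset.sum_const_zero, add_zero]
    exact he.sum_mem _

/-- Nondegeneracy together with isotropy of both summands identifies `P₁` with the dual of `P`; `f`
is the dual basis. -/
theorem exists_darboux [FiniteDimensional ℂ S] (hh : IsSuperhermitian h) {P P₁ : UManifold h}
    (hc : Compl P P₁) {e : Fin n → S} (he : IsFrame P e) :
    ∃ f : Fin n → S, IsFrame P₁ f ∧ IsDarboux h e f := by
  let A : P₁.1 →ₗ[ℂ] (Fin n → ℂ) := LinearMap.pi fun i => (h (e i)) ∘ₗ P₁.1.subtype
  have hinj : Function.Injective A := by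
    refine (injective_iff_map_eq_zero A).2 fun w hw => Subtype.ext ?_
    refine hh.nondegenerate.2 _ fun y => ?_
    obtain ⟨a, ha, b, hb, rfl⟩ := Submodule.mem_sup.1
      (hc.sup_eq_top ▸ Submodule.mem_top : y ∈ P.1 ⊔ P₁.1)
    obtain ⟨c, rfl⟩ := he.exists_coord ha
    have h1 : ∀ i, h (e i) w = 0 := fun i => congrFun hw i
    simp [h1, apply_eq_zero hh.symm P₁.2.2 hb w.2]
  have hsurj : Function.Surjective A := by
    refine (LinearMap.injective_iff_surjective_of_finrank_eq_finrank ?_).1 hinj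
    rw [finrank_fintype_fun_eq_card, Fintype.card_fin]
    have := P₁.2.1
    have := he.card
    omega
  choose f hf using fun j : Fin n => hsurj (Pi.single j 1)
  have H : IsDarboux h e fun j => f j := by
    refine ⟨hh.symm, fun i j => apply_eq_zero hh.symm P.2.2 (he.mem i) (he.mem j),
      fun i j => apply_eq_zero hh.symm P₁.2.2 (f i).2 (f j).2, fun i j => ?_, he.card⟩
    have := congrFun (hf j) i
    rw [Pi.single_apply] at this
    exact this
  exact ⟨_, ⟨fun i => (f i).2, H.swap.linearIndependent_left, he.card⟩, H⟩

/-- Any two superlagrangian subspaces have a common complement. -/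
theorem exists_common_compl [FiniteDimensional ℂ S] (hh : IsSuperhermitian h) (P Q : UManifold h) :
    ∃ P₁ : UManifold h, Compl P P₁ ∧ Compl Q P₁ := by
  obtain ⟨P₂, hP₂⟩ := exists_compl hh P
  obtain ⟨n, hn⟩ := hh.even_dim
  obtain ⟨e, he⟩ := exists_frame P hn.symm
  obtain ⟨f, hf, H⟩ := exists_darboux hh hP₂ he
  obtain ⟨v, hv⟩ := exists_frame Q hn.symm
  -- The polynomial det(X − zY) is nonzero at z = 1, so it has finitely many roots and some z = iτ
  -- on the imaginary axis is not among them.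
  let p : Polynomial ℂ :=
    ((gram h f v).map Polynomial.C - (Polynomial.X : Polynomial ℂ) • (gram h e v).map Polynomial.C).det
  have hp : ∀ z, p.eval z = (gram h f v - z • gram h e v).det := by
    intro z
    rw [← Polynomial.coe_evalRingHom, RingHom.map_det]
    congr 1
    ext i j
    simp
    ring
  have hp0 : p ≠ 0 := by
    intro h0
    have := hp 1
    rw [h0, Polynomial.eval_zero] at this
    exact H.det_sub_smul_ne_zero hv (z := 1) (by simp) this.symm
  obtain ⟨τ, hτ⟩ : ∃ τ : ℝ, (gram h f v - (Complex.I * τ) • gram h e v).det ≠ 0 := by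
    by_contra! hcon
    have hfin := Polynomial.finite_setOfPred_isRoot hp0
    refine Set.infinite_of_injective_forall_mem (f := fun τ : ℝ => Complex.I * (τ : ℂ)) ?_ ?_ hfin
    · intro x y hxy
      simpa using hxy
    · intro τ
      change p.eval _ = 0
      rw [hp, hcon]
  -- Since iτ is skew under conjugation, the shifted family remains isotropic, and its matrix
  -- against `v` is X − iτY.
  have H' : IsDarboux h e (fun i => f i + (Complex.I * τ) • e i) := by
    refine ⟨H.symm, H.left, fun i j => ?_, fun i j => ?_, H.card⟩
    · simp only [map_add, LinearMap.add_apply, LinearMap.map_smulₛₗ, LinearMap.smul_apply, H.left,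
        H.right, H.dual, H.dual']
      by_cases hij : i = j <;> simp [hij]
    · simp [H.left, H.dual]
  refine ⟨H'.swap.leftSpan, ?_, ?_⟩
  · rw [← H'.swap.isUnit_gram_iff H'.swap.isFrame_leftSpan he]
    have : gram h (fun i => f i + (Complex.I * τ) • e i) e = 1 := by
      ext i j
      simp [gram, H.dual', H.left, one_apply]
    rw [this]
    exact isUnit_one
  · rw [← H'.swap.isUnit_gram_iff H'.swap.isFrame_leftSpan hv, isUnit_iff_isUnit_det,
      isUnit_iff_ne_zero]
    have : gram h (fun i => f i + (Complex.I * τ) • e i) v =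
        gram h f v - (Complex.I * τ) • gram h e v := by
      ext i j
      simp [gram]
      ring
    rwa [this]

end Darboux

/-! ### Charts in matrix coordinates -/

section Charts

variable {S : Type*} [AddCommGroup S] [Module ℂ S] {h : S →ₗ⋆[ℂ] S →ₗ[ℂ] ℂ} {n : ℕ}

open Classical in
/-- The projection on `Q` along a complement `P₁` (zero if `P₁` is not a complement). -/
def projAlong (P₁ Q : UManifold h) : S →ₗ[ℂ] S :=
  if hc : IsCompl Q.1 P₁.1 then Q.1.projection P₁.1 hc else 0

theorem projAlong_eq_projection {P₁ Q : UManifold h} (hc : IsCompl Q.1 P₁.1) :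
    projAlong P₁ Q = Q.1.projection P₁.1 hc :=
  dif_pos hc

theorem projAlong_mem (P₁ Q : UManifold h) (u : S) : projAlong P₁ Q u ∈ Q.1 := by
  rw [projAlong]
  split_ifs with hc
  · exact Submodule.projection_apply_mem hc u
  · exact Q.1.zero_mem

theorem projAlong_sub_mem {P₁ Q : UManifold h} (hc : Compl Q P₁) (u : S) :
    projAlong P₁ Q u - u ∈ P₁.1 := by
  rw [projAlong_eq_projection hc]
  have h1 := Submodule.projection_add_projection_eq_self hc u
  have h2 : Q.1.projection P₁.1 hc u - u = -(P₁.1.projection Q.1 hc.symm u) := by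
    rw [eq_comm, neg_eq_iff_eq_neg, neg_sub]
    exact eq_sub_of_add_eq' h1
  rw [h2]
  exact P₁.1.neg_mem (Submodule.projection_apply_mem _ _)

theorem projAlong_of_mem {P₁ Q : UManifold h} (hc : Compl Q P₁) {u : S} (hu : u ∈ Q.1) :
    projAlong P₁ Q u = u := by
  rw [projAlong_eq_projection hc]
  exact Submodule.projection_apply_of_mem_left hc hu

/-- Write t for the `P₁`-component of the projection of u. Expanding h[u − it], the terms h[u] and
h[t] vanish by isotropy and the cross term remains; h(u, t) is then h(u, u + t). -/
theorem chart_eq (hs : h.IsSymm) (P : UManifold h) {P₁ Q : UManifold h} (hc : Compl Q P₁)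
    (u : P.1) : chart P P₁ Q u = 2 * (-Complex.I * h u (projAlong P₁ Q u)).re := by
  have h1 := projAlong_sub_mem hc (u : S)
  have e1 : chart P P₁ Q u = realForm h ((u : S) - Complex.I • (projAlong P₁ Q u - (u : S))) := by
    rw [projAlong_eq_projection hc]
    exact dif_pos hc
  rw [e1]
  set t := projAlong P₁ Q u - (u : S) with ht
  have e2 : projAlong P₁ Q u = u + t := by rw [ht]; abel
  have e3 : h u u = 0 := apply_eq_zero hs P.2.2 u.2 u.2
  have e4 : h t t = 0 := apply_eq_zero hs P₁.2.2 h1 h1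
  have e5 := hs.eq u t
  rw [e2, realForm]
  simp only [map_sub, map_add, LinearMap.sub_apply, LinearMap.map_smulₛₗ, LinearMap.smul_apply,
    smul_eq_mul, e3, e4, ← e5]
  simp
  ring

/-- The coordinate matrix of the chart centred at the span of `e`. -/
def graphMat (e : Fin n → S) (P₁ Q : UManifold h) : Matrix (Fin n) (Fin n) ℂ :=
  -Complex.I • gram h e fun j => projAlong P₁ Q (e j)

/-- Projecting `e` to `Q` along `P₁` changes it only by vectors of `P₁`, orthogonal to `f`. This
normalizes the frame of `Q` to X = 1. -/
theorem gram_projAlong {e f : Fin n → S} (H : IsDarboux h e f) {P₁ Q : UManifold h}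
    (hf : IsFrame P₁ f) (hc : Compl Q P₁) : gram h f (fun j => projAlong P₁ Q (e j)) = 1 := by
  ext i j
  have h1 := apply_eq_zero H.symm P₁.2.2 (hf.mem i) (projAlong_sub_mem hc (e j))
  rw [map_sub, sub_eq_zero, H.dual'] at h1
  rw [gram, of_apply, h1, one_apply]

theorem isFrame_projAlong {e f : Fin n → S} (H : IsDarboux h e f) {P₁ Q : UManifold h}
    (hf : IsFrame P₁ f) (hc : Compl Q P₁) : IsFrame Q fun j => projAlong P₁ Q (e j) := by
  refine ⟨fun j => projAlong_mem _ _ _, ?_, H.card⟩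
  refine Fintype.linearIndependent_iff.2 fun c hc0 i => ?_
  have h1 := gram_mulVec (h := h) f (fun j => projAlong P₁ Q (e j)) c i
  rw [gram_projAlong H hf hc, hc0, one_mulVec, map_zero] at h1
  exact h1

/-- With X = 1, isotropy X*Y + Y*X = 0 says that Y is skew-Hermitian. -/
theorem isHermitian_graphMat [FiniteDimensional ℂ S] {e f : Fin n → S} (H : IsDarboux h e f)
    {P₁ Q : UManifold h} (hf : IsFrame P₁ f) (hc : Compl Q P₁) :
    (graphMat e P₁ Q).IsHermitian := by
  have h1 := H.gram_self (fun j => projAlong P₁ Q (e j)) (fun j => projAlong P₁ Q (e j))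
  rw [gram_isotropic H.symm (fun i => projAlong_mem P₁ Q _) (fun i => projAlong_mem P₁ Q _),
    gram_projAlong H hf hc, conjTranspose_one, one_mul, mul_one] at h1
  rw [IsHermitian, graphMat, conjTranspose_smul, eq_neg_of_add_eq_zero_right h1.symm]
  simp

theorem matForm_graphMat {e : Fin n → S} (P₁ Q : UManifold h) (c : Fin n → ℂ) :
    matForm (graphMat e P₁ Q) c =
      (-Complex.I * h (∑ i, c i • e i) (projAlong P₁ Q (∑ i, c i • e i))).re := by
  rw [matForm, graphMat, smul_mulVec, dotProduct_smul, smul_eq_mul]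
  congr 2
  rw [map_sum h, LinearMap.sum_apply]
  refine Finset.sum_congr rfl fun i _ => ?_
  rw [gram_mulVec, LinearMap.map_smulₛₗ, LinearMap.smul_apply, map_sum (projAlong P₁ Q)]
  simp only [map_smul, smul_eq_mul, Pi.star_apply, RCLike.star_def]

theorem chart_equiv [FiniteDimensional ℂ S] (hs : h.IsSymm) {P : UManifold h} {e : Fin n → S}
    (he : IsFrame P e) {P₁ Q : UManifold h} (hc : Compl Q P₁) (c : Fin n → ℂ) :
    chart P P₁ Q (he.equiv c) = 2 * matForm (graphMat e P₁ Q) c := by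
  rw [chart_eq hs P hc, matForm_graphMat, he.equiv_apply]

theorem sign_chart [FiniteDimensional ℂ S] (hs : h.IsSymm) {P : UManifold h} {e : Fin n → S}
    (he : IsFrame P e) {P₁ Q : UManifold h} (hc : Compl Q P₁) :
    sign (chart P P₁ Q) = sign (matForm (graphMat e P₁ Q)) :=
  sign_congr he.equiv two_pos fun c => chart_equiv hs he hc c

/-- Polarization for Hermitian matrices. -/
theorem IsHermitian.entry_eq {M : Matrix (Fin n) (Fin n) ℂ} (hM : M.IsHermitian) (i j : Fin n) :
    M i j = (1 / 2) * (((matForm M (Pi.single j 1 + Pi.single i 1) - matForm M (Pi.single j 1) -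
        matForm M (Pi.single i 1) : ℝ) : ℂ) -
      Complex.I * ((matForm M (Pi.single j Complex.I + Pi.single i 1) -
        matForm M (Pi.single j Complex.I) - matForm M (Pi.single i 1) : ℝ) : ℂ)) := by
  have h1 : ∀ z : ℂ, star (Pi.single i 1 : Fin n → ℂ) ⬝ᵥ M *ᵥ Pi.single j z = M i j * z := by
    intro z
    rw [← Pi.single_star, star_one, single_one_dotProduct, mulVec_single]
    simp
  rw [matForm_add_right hM, matForm_add_right hM, h1, h1]
  apply Complex.ext
  · simp
    ring
  · simp
    ring

/-- Each entry is a fixed linear combination of chart values, so continuity and differentiability in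
charts pass to the matrix. -/
theorem graphMat_entry_eq [FiniteDimensional ℂ S] {e f : Fin n → S} (H : IsDarboux h e f)
    {P P₁ Q : UManifold h} (he : IsFrame P e) (hf : IsFrame P₁ f) (hc : Compl Q P₁)
    (i j : Fin n) :
    graphMat e P₁ Q i j =
      (1 / 4) * (((chart P P₁ Q (he.equiv (Pi.single j 1 + Pi.single i 1)) -
        chart P P₁ Q (he.equiv (Pi.single j 1)) - chart P P₁ Q (he.equiv (Pi.single i 1)) : ℝ) : ℂ) -
      Complex.I * ((chart P P₁ Q (he.equiv (Pi.single j Complex.I + Pi.single i 1)) -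
        chart P P₁ Q (he.equiv (Pi.single j Complex.I)) -
        chart P P₁ Q (he.equiv (Pi.single i 1)) : ℝ) : ℂ)) := by
  rw [IsHermitian.entry_eq (isHermitian_graphMat H hf hc) i j]
  simp only [chart_equiv H.symm he hc]
  push_cast
  ring

theorem projAlong_eq [FiniteDimensional ℂ S] {e f : Fin n → S} (H : IsDarboux h e f)
    {P₁ Q : UManifold h} (hf : IsFrame P₁ f) (hc : Compl Q P₁) (j : Fin n) :
    projAlong P₁ Q (e j) = e j + Complex.I • ∑ i, graphMat e P₁ Q i j • f i := by
  conv_lhs => rw [← H.expansion (projAlong P₁ Q (e j))]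
  have h1 : ∀ i, h (f i) (projAlong P₁ Q (e j)) = if i = j then 1 else 0 := fun i => by
    have := congrFun (congrFun (gram_projAlong H hf hc) i) j
    rwa [one_apply] at this
  have h2 : ∀ i, h (e i) (projAlong P₁ Q (e j)) = Complex.I * graphMat e P₁ Q i j := fun i => by
    rw [graphMat, Matrix.smul_apply, gram, of_apply, smul_eq_mul, ← mul_assoc]
    simp
  simp [h1, h2, Finset.smul_sum, smul_smul]

theorem isOpen_compl [FiniteDimensional ℂ S] (hh : IsSuperhermitian h) (P₁ : UManifold h) :
    IsOpen {Q : UManifold h | Compl Q P₁} := by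
  obtain ⟨P, hP⟩ := exists_compl hh P₁
  refine TopologicalSpace.isOpen_generateFrom_of_mem ⟨P, P₁, hP.symm, univ, isOpen_univ, ?_⟩
  simp

theorem continuousOn_chart {P P₁ : UManifold h} (hc : Compl P P₁) :
    ContinuousOn (chart P P₁) {Q : UManifold h | Compl Q P₁} := by
  refine continuousOn_iff'.2 fun O hO => ⟨{Q | Compl Q P₁ ∧ chart P P₁ Q ∈ O}, ?_, ?_⟩
  · exact TopologicalSpace.isOpen_generateFrom_of_mem ⟨P, P₁, hc, O, hO, rfl⟩
  · ext Q
    exact ⟨fun hQ => ⟨⟨hQ.2, hQ.1⟩, hQ.2⟩, fun hQ => ⟨hQ.1.2, hQ.2⟩⟩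

theorem continuousOn_graphMat [FiniteDimensional ℂ S] {e f : Fin n → S} (H : IsDarboux h e f)
    {P P₁ : UManifold h} (he : IsFrame P e) (hf : IsFrame P₁ f) (hPP : Compl P P₁) :
    ContinuousOn (graphMat e P₁) {Q : UManifold h | Compl Q P₁} := by
  refine continuousOn_pi.2 fun i => continuousOn_pi.2 fun j => ?_
  refine ContinuousOn.congr ?_ fun Q hQ => graphMat_entry_eq H he hf hQ i j
  have hch : ∀ u : P.1, ContinuousOn (fun Q => ((chart P P₁ Q u : ℝ) : ℂ))
      {Q : UManifold h | Compl Q P₁} := fun u =>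
    Complex.continuous_ofReal.comp_continuousOn (continuousOn_pi.1 (continuousOn_chart hPP) u)
  push_cast
  refine continuousOn_const.mul (ContinuousOn.sub ?_ (continuousOn_const.mul ?_))
  · exact ((hch _).sub (hch _)).sub (hch _)
  · exact ((hch _).sub (hch _)).sub (hch _)

theorem gram_projAlong_eq [FiniteDimensional ℂ S] {e f : Fin n → S} (H : IsDarboux h e f)
    {P₁ Q : UManifold h} (hf : IsFrame P₁ f) (hc : Compl Q P₁) (g : Fin n → S) :
    gram h g (fun j => projAlong P₁ Q (e j)) =
      gram h g e + Complex.I • (gram h g f * graphMat e P₁ Q) := by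
  ext i j
  simp [gram, projAlong_eq H hf hc, mul_apply, mul_comm]

/-- Near every superlagrangian subspace there is a continuous family of frames. -/
theorem exists_local_frame [FiniteDimensional ℂ S] (hh : IsSuperhermitian h)
    (hn : n + n = finrank ℂ S) (Q₀ : UManifold h) :
    ∃ w : UManifold h → Fin n → S, (∀ᶠ Q in 𝓝 Q₀, IsFrame Q (w Q)) ∧
      ∀ g : Fin n → S, Tendsto (fun Q => gram h g (w Q)) (𝓝 Q₀) (𝓝 (gram h g (w Q₀))) := by
  obtain ⟨P₁, hP₁⟩ := exists_compl hh Q₀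
  obtain ⟨e, he⟩ := exists_frame Q₀ hn
  obtain ⟨f, hf, H⟩ := exists_darboux hh hP₁ he
  have hev : ∀ᶠ Q in 𝓝 Q₀, Compl Q P₁ := (isOpen_compl hh P₁).mem_nhds hP₁
  refine ⟨fun Q j => projAlong P₁ Q (e j), hev.mono fun Q hQ => isFrame_projAlong H hf hQ,
    fun g => ?_⟩
  have h1 : Tendsto (graphMat e P₁) (𝓝 Q₀) (𝓝 (graphMat e P₁ Q₀)) :=
    (continuousOn_graphMat H he hf hP₁).continuousAt ((isOpen_compl hh P₁).mem_nhds hP₁)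
  rw [gram_projAlong_eq H hf hP₁]
  refine Tendsto.congr' (hev.mono fun Q hQ => (gram_projAlong_eq H hf hQ g).symm) ?_
  exact tendsto_const_nhds.add ((tendsto_const_nhds.mul h1).const_smul Complex.I)

end Charts

/-! ### Continuous logarithms and winding integers -/

section Winding

/-- The function takes values in 2πiℤ, which is countable and hence totally disconnected. -/
theorem constant_of_exp_eq_one {s : Set ℝ} (hs : IsPreconnected s) {g : ℝ → ℂ}
    (hg : ContinuousOn g s) (h1 : ∀ t ∈ s, Complex.exp (g t) = 1) {x y : ℝ} (hx : x ∈ s)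
    (hy : y ∈ s) : g x = g y := by
  have hT : (range fun m : ℤ => (m : ℂ) * (2 * Real.pi * Complex.I)).Countable :=
    countable_range _
  refine hT.isTotallyDisconnected _ ?_ (hs.image g hg) (mem_image_of_mem g hx) (mem_image_of_mem g hy)
  rintro _ ⟨t, ht, rfl⟩
  obtain ⟨m, hm⟩ := Complex.exp_eq_one_iff.1 (h1 t ht)
  exact ⟨m, hm.symm⟩

theorem exists_lift {a b : ℝ} (hab : a ≤ b) {D : ℝ × ℝ → ℂ}
    (hD : ContinuousOn D (Icc 0 1 ×ˢ Icc a b)) (h0 : ∀ x ∈ Icc (0 : ℝ) 1 ×ˢ Icc a b, D x ≠ 0) :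
    ∃ Θ : ℝ × ℝ → ℂ, ContinuousOn Θ (Icc 0 1 ×ˢ Icc a b) ∧
      ∀ x ∈ Icc (0 : ℝ) 1 ×ˢ Icc a b, Complex.exp (Θ x) = D x := by
  -- Clamping to the rectangle extends `D` without zeros to the simply connected plane, where a
  -- logarithm exists.
  let c : ℝ × ℝ → ℝ × ℝ := fun x => (projIcc 0 1 zero_le_one x.1, projIcc a b hab x.2)
  have hc : Continuous c := by
    refine Continuous.prodMk ?_ ?_
    · exact continuous_subtype_val.comp (continuous_projIcc.comp continuous_fst)
    · exact continuous_subtype_val.comp (continuous_projIcc.comp continuous_snd)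
  have hmem : ∀ x, c x ∈ Icc (0 : ℝ) 1 ×ˢ Icc a b := fun x => ⟨Subtype.coe_prop _, Subtype.coe_prop _⟩
  have hcid : ∀ x ∈ Icc (0 : ℝ) 1 ×ˢ Icc a b, c x = x := by
    rintro ⟨s, t⟩ ⟨hs, ht⟩
    simp only [c]
    rw [projIcc_of_mem zero_le_one hs, projIcc_of_mem hab ht]
  have hcont : Continuous (D ∘ c) := hD.comp_continuous hc hmem
  have hsc : IsSimplyConnected (univ : Set (ℝ × ℝ)) := by
    have := (convex_univ (𝕜 := ℝ) (E := ℝ × ℝ)).contractibleSpace univ_nonempty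
    exact SimplyConnectedSpace.ofContractible _
  obtain ⟨Θ, hΘ, hΘD⟩ := Complex.exists_continuousOn_eqOn_exp_comp hsc isOpen_univ
    (g := D ∘ c) hcont.continuousOn (by
      rintro ⟨x, -, hx⟩
      exact h0 _ (hmem x) hx)
  refine ⟨Θ, hΘ.mono (subset_univ _), fun x hx => ?_⟩
  have := hΘD (mem_univ x)
  rwa [Function.comp_apply, Function.comp_apply, hcid x hx] at this

/-- A continuous logarithm of `D` on `[a, b]` increases by `i (β - α) + 2 π i m`. -/
def Winds (a b : ℝ) (D : ℝ → ℂ) (α β : ℝ) (m : ℤ) : Prop :=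
  ∃ θ : ℝ → ℂ, ContinuousOn θ (Icc a b) ∧ (∀ t ∈ Icc a b, Complex.exp (θ t) = D t) ∧
    θ b - θ a = Complex.I * (β - α) + m * (2 * Real.pi * Complex.I)

/-- Two continuous logarithms differ by a constant, so every logarithm has the same increment. -/
theorem Winds.of_lift {a b : ℝ} (hab : a ≤ b) {D : ℝ → ℂ} {α β : ℝ} {m : ℤ}
    (hm : Winds a b D α β m) {θ : ℝ → ℂ} (hθ : ContinuousOn θ (Icc a b))
    (hD : ∀ t ∈ Icc a b, Complex.exp (θ t) = D t) :
    θ b - θ a = Complex.I * (β - α) + m * (2 * Real.pi * Complex.I) := by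
  obtain ⟨η, hη, hηD, h1⟩ := hm
  have h2 := constant_of_exp_eq_one isPreconnected_Icc (hθ.sub hη) (fun t ht => by
    rw [Pi.sub_apply, Complex.exp_sub, hD t ht, hηD t ht, div_self]
    rw [← hD t ht]
    exact Complex.exp_ne_zero _) (left_mem_Icc.2 hab) (right_mem_Icc.2 hab)
  simp only [Pi.sub_apply] at h2
  rw [← h1]
  linear_combination -h2

/-- The factor `κ`, common to both endpoint values, cancels in their quotient; hence the corrected
increment lies in 2πiℤ. -/
theorem exists_winds_of_lift {a b : ℝ} {D : ℝ → ℂ} {α β : ℝ} {κ : ℂ} (hab : a ≤ b)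
    {θ : ℝ → ℂ} (hθ : ContinuousOn θ (Icc a b)) (hD : ∀ t ∈ Icc a b, Complex.exp (θ t) = D t)
    (ha : D a = κ * Complex.exp (Complex.I * α)) (hb : D b = κ * Complex.exp (Complex.I * β)) :
    ∃ m, Winds a b D α β m := by
  have e1 := hD a (left_mem_Icc.2 hab)
  have e2 := hD b (right_mem_Icc.2 hab)
  have hκ : κ ≠ 0 := by
    rintro rfl
    rw [zero_mul] at ha
    rw [ha] at e1
    exact Complex.exp_ne_zero _ e1
  have h1 : Complex.exp (θ b - θ a - Complex.I * (β - α)) = 1 := by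
    rw [mul_sub, Complex.exp_sub, Complex.exp_sub, Complex.exp_sub, e1, e2, ha, hb]
    have := Complex.exp_ne_zero (Complex.I * α)
    have := Complex.exp_ne_zero (Complex.I * β)
    field_simp
  obtain ⟨m, hm⟩ := Complex.exp_eq_one_iff.1 h1
  exact ⟨m, θ, hθ, hD, by linear_combination hm⟩

theorem exists_winds {a b : ℝ} (hab : a ≤ b) {D : ℝ → ℂ} (hD : ContinuousOn D (Icc a b))
    (h0 : ∀ t ∈ Icc a b, D t ≠ 0) {α β : ℝ} {κ : ℂ}
    (ha : D a = κ * Complex.exp (Complex.I * α)) (hb : D b = κ * Complex.exp (Complex.I * β)) :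
    ∃ m, Winds a b D α β m := by
  obtain ⟨Θ, hΘ, hΘD⟩ := exists_lift hab (D := fun x => D x.2)
    (hD.comp continuousOn_snd fun x hx => hx.2) fun x hx => h0 _ hx.2
  have hmem : ∀ t ∈ Icc a b, ((0 : ℝ), t) ∈ Icc (0 : ℝ) 1 ×ˢ Icc a b := fun t ht => ⟨by simp, ht⟩
  refine exists_winds_of_lift hab (θ := fun t => Θ (0, t)) ?_ (fun t ht => hΘD _ (hmem t ht)) ha hb
  exact hΘ.comp (by fun_prop) hmem

/-- On a joint logarithm over the rectangle, the corrected increment is continuous in s with values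
in 2πiℤ, so it is constant. -/
theorem Winds.homotopy {a b : ℝ} (hab : a ≤ b) {D : ℝ → ℝ → ℂ}
    (hD : ContinuousOn (fun x : ℝ × ℝ => D x.1 x.2) (Icc 0 1 ×ˢ Icc a b))
    (h0 : ∀ s ∈ Icc (0 : ℝ) 1, ∀ t ∈ Icc a b, D s t ≠ 0) {α β : ℝ → ℝ} {κ : ℂ}
    (hα : ContinuousOn α (Icc 0 1)) (hβ : ContinuousOn β (Icc 0 1))
    (ha : ∀ s ∈ Icc (0 : ℝ) 1, D s a = κ * Complex.exp (Complex.I * α s))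
    (hb : ∀ s ∈ Icc (0 : ℝ) 1, D s b = κ * Complex.exp (Complex.I * β s)) {m₀ m₁ : ℤ}
    (hm₀ : Winds a b (D 0) (α 0) (β 0) m₀) (hm₁ : Winds a b (D 1) (α 1) (β 1) m₁) : m₀ = m₁ := by
  obtain ⟨Θ, hΘ, hΘD⟩ := exists_lift hab hD fun x hx => h0 _ hx.1 _ hx.2
  have hsec : ∀ s ∈ Icc (0 : ℝ) 1, ContinuousOn (fun t => Θ (s, t)) (Icc a b) := fun s hs =>
    hΘ.comp (by fun_prop) fun t ht => ⟨hs, ht⟩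
  have hsec' : ∀ t ∈ Icc a b, ContinuousOn (fun s => Θ (s, t)) (Icc 0 1) := fun t ht =>
    hΘ.comp (by fun_prop) fun s hs => ⟨hs, ht⟩
  have hcast : ∀ {γ : ℝ → ℝ}, ContinuousOn γ (Icc 0 1) →
      ContinuousOn (fun s => (γ s : ℂ)) (Icc 0 1) :=
    fun h => Complex.continuous_ofReal.comp_continuousOn h
  have hκ : κ ≠ 0 := by
    rintro rfl
    have := ha 0 (by simp)
    rw [zero_mul] at this
    exact h0 0 (by simp) a (left_mem_Icc.2 hab) this
  have hg : ContinuousOn (fun s => Θ (s, b) - Θ (s, a) - Complex.I * (β s - α s)) (Icc 0 1) :=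
    ((hsec' b (right_mem_Icc.2 hab)).sub (hsec' a (left_mem_Icc.2 hab))).sub
      (continuousOn_const.mul ((hcast hβ).sub (hcast hα)))
  have h1 := constant_of_exp_eq_one isPreconnected_Icc hg (fun s hs => by
    have e1 := hΘD (s, a) ⟨hs, left_mem_Icc.2 hab⟩
    have e2 := hΘD (s, b) ⟨hs, right_mem_Icc.2 hab⟩
    simp only [ha s hs, hb s hs] at e1 e2
    rw [mul_sub, Complex.exp_sub, Complex.exp_sub, Complex.exp_sub, e1, e2]
    have := Complex.exp_ne_zero (Complex.I * α s)
    have := Complex.exp_ne_zero (Complex.I * β s)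
    field_simp) (left_mem_Icc.2 zero_le_one) (right_mem_Icc.2 zero_le_one)
  have e0 := hm₀.of_lift hab (hsec 0 (by simp)) fun t ht => hΘD (0, t) ⟨by simp, ht⟩
  have e1 := hm₁.of_lift hab (hsec 1 (by simp)) fun t ht => hΘD (1, t) ⟨by simp, ht⟩
  have h2 : (m₀ : ℂ) * (2 * Real.pi * Complex.I) = m₁ * (2 * Real.pi * Complex.I) := by
    linear_combination h1 - e0 + e1
  have h3 := mul_right_cancel₀ Complex.two_pi_I_ne_zero h2
  exact_mod_cast h3

theorem Winds.unique {a b : ℝ} (hab : a ≤ b) {D : ℝ → ℂ} {α β : ℝ} {m₀ m₁ : ℤ}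
    (hm₀ : Winds a b D α β m₀) (hm₁ : Winds a b D α β m₁) : m₀ = m₁ := by
  obtain ⟨θ, hθ, hθD, h1⟩ := hm₀
  have h2 := hm₁.of_lift hab hθ hθD
  have h3 : (m₀ : ℂ) * (2 * Real.pi * Complex.I) = m₁ * (2 * Real.pi * Complex.I) := by
    linear_combination h2 - h1
  have h4 := mul_right_cancel₀ Complex.two_pi_I_ne_zero h3
  exact_mod_cast h4

theorem Winds.trans {a c b : ℝ} (hac : a ≤ c) (hcb : c ≤ b) {D : ℝ → ℂ} {α β γ : ℝ} {m₀ m₁ m : ℤ}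
    (hm₀ : Winds a c D α γ m₀) (hm₁ : Winds c b D γ β m₁) (hm : Winds a b D α β m) :
    m = m₀ + m₁ := by
  obtain ⟨θ, hθ, hθD, h1⟩ := hm
  have h2 := hm₀.of_lift hac (hθ.mono (Icc_subset_Icc_right hcb)) fun t ht =>
    hθD t ⟨ht.1, ht.2.trans hcb⟩
  have h3 := hm₁.of_lift hcb (hθ.mono (Icc_subset_Icc_left hac)) fun t ht =>
    hθD t ⟨hac.trans ht.1, ht.2⟩
  have h4 : (m : ℂ) * (2 * Real.pi * Complex.I) = (m₀ + m₁ : ℂ) * (2 * Real.pi * Complex.I) := by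
    linear_combination h2 + h3 - h1
  have h5 := mul_right_cancel₀ Complex.two_pi_I_ne_zero h4
  exact_mod_cast h5

end Winding

theorem arctanTrace_neg {n : Type*} [Fintype n] [DecidableEq n] {M : Matrix n n ℂ}
    (hM : M.IsHermitian) : arctanTrace (-M) = -arctanTrace M := by
  have h1 : cfc Real.arctan (-M) = -cfc Real.arctan M := by
    have h2 : cfc (fun x => Real.arctan (-x)) M = cfc Real.arctan (-M) :=
      cfc_comp_neg Real.arctan M Real.continuous_arctan.continuousOn hM
    rw [← h2, ← cfc_neg]
    simp only [Real.arctan_neg]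
  rw [arctanTrace, arctanTrace, h1]
  simp

/-! ### The determinant function on superlagrangians and its argument -/

section Index

variable {S : Type*} [AddCommGroup S] [Module ℂ S] {h : S →ₗ⋆[ℂ] S →ₗ[ℂ] ℂ} {n : ℕ}

open Classical in
/-- A chosen frame of a superlagrangian subspace. -/
def someFrame (n : ℕ) (Q : UManifold h) : Fin n → S :=
  if hv : ∃ v : Fin n → S, IsFrame Q v then hv.choose else 0

theorem isFrame_someFrame [FiniteDimensional ℂ S] (hn : n + n = finrank ℂ S) (Q : UManifold h) :
    IsFrame Q (someFrame n Q) := by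
  rw [someFrame, dif_pos (exists_frame Q hn)]
  exact (exists_frame Q hn).choose_spec

/-- A change of frame multiplies X and Y on the right by one and the same matrix; therefore the
determinant quotient and XY⁻¹ depend only on `Q`. -/
theorem IsFrame.exists_transition [FiniteDimensional ℂ S] {Q : UManifold h} {v w : Fin n → S}
    (hv : IsFrame Q v) (hw : IsFrame Q w) :
    ∃ G : Matrix (Fin n) (Fin n) ℂ, IsUnit G ∧ ∀ g : Fin n → S, gram h g w = gram h g v * G := by
  choose c hc using fun j => hv.exists_coord (hw.mem j)
  have hG : w = fun j => ∑ i, (Matrix.of fun i j => c j i) i j • v i := funext hc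
  refine ⟨Matrix.of fun i j => c j i, ?_, fun g => ?_⟩
  · rw [← mulVec_injective_iff_isUnit]
    refine (injective_iff_map_eq_zero (mulVecLin _)).2 fun d hd => hw.sum_eq_zero ?_
    have h1 : ∀ i, ∑ j, c j i * d j = 0 := fun i => congrFun hd i
    simp only [hc, Finset.smul_sum, smul_smul]
    rw [Finset.sum_comm]
    refine Finset.sum_eq_zero fun i _ => ?_
    rw [← Finset.sum_smul]
    simp only [mul_comm (d _), h1, zero_smul]
  · conv_lhs => rw [hG]
    exact gram_mul g v _

/-- The determinant of the unitary matrix which represents a superlagrangian subspace. -/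
def unitaryDet (e f : Fin n → S) (Q : UManifold h) : ℂ :=
  (gram h f (someFrame n Q) + gram h e (someFrame n Q)).det /
    (gram h f (someFrame n Q) - gram h e (someFrame n Q)).det

/-- The matrix `-i X Y⁻¹` of the superlagrangian subspace with frame `(X, Y)`. -/
def slopeMat (e f : Fin n → S) (Q : UManifold h) : Matrix (Fin n) (Fin n) ℂ :=
  -Complex.I • (gram h f (someFrame n Q) * (gram h e (someFrame n Q))⁻¹)

theorem IsDarboux.det_sub_ne_zero [FiniteDimensional ℂ S] {e f : Fin n → S}
    (H : IsDarboux h e f) {Q : UManifold h} {v : Fin n → S} (hv : IsFrame Q v) :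
    (gram h f v - gram h e v).det ≠ 0 := by
  simpa using H.det_sub_smul_ne_zero hv (z := 1) (by simp)

theorem IsDarboux.det_add_ne_zero [FiniteDimensional ℂ S] {e f : Fin n → S}
    (H : IsDarboux h e f) {Q : UManifold h} {v : Fin n → S} (hv : IsFrame Q v) :
    (gram h f v + gram h e v).det ≠ 0 := by
  simpa using H.det_sub_smul_ne_zero hv (z := -1) (by simp)

theorem IsDarboux.unitaryDet_eq [FiniteDimensional ℂ S] {e f : Fin n → S}
    (H : IsDarboux h e f) {Q : UManifold h} {v : Fin n → S} (hv : IsFrame Q v) :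
    unitaryDet e f Q = (gram h f v + gram h e v).det / (gram h f v - gram h e v).det := by
  obtain ⟨G, hG, hgram⟩ := (isFrame_someFrame H.card Q).exists_transition hv
  have hd : G.det ≠ 0 := ((isUnit_iff_isUnit_det G).1 hG).ne_zero
  rw [unitaryDet, hgram, hgram, ← add_mul, ← sub_mul, det_mul, det_mul, mul_div_mul_right _ _ hd]

theorem IsDarboux.unitaryDet_ne_zero [FiniteDimensional ℂ S] {e f : Fin n → S}
    (H : IsDarboux h e f) (Q : UManifold h) : unitaryDet e f Q ≠ 0 :=
  div_ne_zero (H.det_add_ne_zero (isFrame_someFrame H.card Q))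
    (H.det_sub_ne_zero (isFrame_someFrame H.card Q))

theorem slopeMat_eq [FiniteDimensional ℂ S] (e f : Fin n → S) {Q : UManifold h} {v : Fin n → S}
    (hv : IsFrame Q v) : slopeMat e f Q = -Complex.I • (gram h f v * (gram h e v)⁻¹) := by
  obtain ⟨G, hG, hgram⟩ := (isFrame_someFrame hv.card Q).exists_transition hv
  have hd : IsUnit G.det := (isUnit_iff_isUnit_det G).1 hG
  rw [slopeMat, hgram, hgram, Matrix.mul_inv_rev, mul_assoc (gram h f (someFrame n Q)) G,
    mul_nonsing_inv_cancel_left _ _ hd]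

theorem slopeMat_eq_graphMat [FiniteDimensional ℂ S] {e f : Fin n → S} (H : IsDarboux h e f)
    {P₀ Q : UManifold h} (he : IsFrame P₀ e) (hc : Compl Q P₀) :
    slopeMat e f Q = graphMat f P₀ Q := by
  rw [slopeMat_eq e f (isFrame_projAlong H.swap he hc), gram_projAlong H.swap he hc, inv_one,
    mul_one, graphMat]

/-- The correction term of the index at an endpoint. -/
def phase (e f : Fin n → S) (Q : UManifold h) : ℝ := 2 * arctanTrace (slopeMat e f Q)

/-- In the frame with Y = 1 and X = iR the quotient is det(1 + iR)/det(iR − 1); the sign (−1)ⁿ comes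
from reversing iR − 1. -/
theorem unitaryDet_eq_phase [FiniteDimensional ℂ S] {e f : Fin n → S} (H : IsDarboux h e f)
    {P₀ Q : UManifold h} (he : IsFrame P₀ e) (hc : Compl Q P₀) :
    unitaryDet e f Q = (-1) ^ n * Complex.exp (Complex.I * phase e f Q) := by
  have hR := isHermitian_graphMat H.swap he hc
  have hv := isFrame_projAlong H.swap he hc
  have hX : gram h f (fun j => projAlong P₀ Q (f j)) = Complex.I • graphMat f P₀ Q := by
    rw [graphMat, smul_smul]
    simp
  have hd := H.det_sub_ne_zero hv
  rw [H.unitaryDet_eq hv, div_eq_iff hd, gram_projAlong H.swap he hc, hX, phase,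
    slopeMat_eq_graphMat H he hc, add_comm, det_one_add_I_smul hR, ← neg_sub, det_neg,
    Fintype.card_fin]
  push_cast
  ring_nf

theorem unitaryDet_eq_exp [FiniteDimensional ℂ S] {e f : Fin n → S} (H : IsDarboux h e f)
    {P₁ Q : UManifold h} (hf : IsFrame P₁ f) (hc : Compl Q P₁) :
    unitaryDet e f Q = Complex.exp (2 * Complex.I * arctanTrace (graphMat e P₁ Q)) := by
  have hR := isHermitian_graphMat H hf hc
  have hv := isFrame_projAlong H hf hc
  have hY : gram h e (fun j => projAlong P₁ Q (e j)) = Complex.I • graphMat e P₁ Q := by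
    rw [graphMat, smul_smul]
    simp
  have hd := H.det_sub_ne_zero hv
  rw [H.unitaryDet_eq hv, div_eq_iff hd, gram_projAlong H hf hc, hY, det_one_add_I_smul hR,
    mul_comm]

theorem isUnit_graphMat [FiniteDimensional ℂ S] {e f : Fin n → S} (H : IsDarboux h e f)
    {P₀ P₁ Q : UManifold h} (he : IsFrame P₀ e) (hf : IsFrame P₁ f) (hc : Compl Q P₁)  :
    IsUnit (graphMat e P₁ Q) ↔ Compl Q P₀ := by
  rw [← H.isUnit_gram_iff he (isFrame_projAlong H hf hc), graphMat, isUnit_iff_isUnit_det,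
    isUnit_iff_isUnit_det, det_smul, IsUnit.mul_iff]
  simp [isUnit_iff_ne_zero]

theorem slopeMat_eq_neg_inv [FiniteDimensional ℂ S] {e f : Fin n → S} (H : IsDarboux h e f)
    {P₀ P₁ Q : UManifold h} (he : IsFrame P₀ e) (hf : IsFrame P₁ f) (hc₀ : Compl Q P₀)
    (hc : Compl Q P₁) : slopeMat e f Q = -(graphMat e P₁ Q)⁻¹ := by
  have hv := isFrame_projAlong H hf hc
  have hu : IsUnit (gram h e fun j => projAlong P₁ Q (e j)) := (H.isUnit_gram_iff he hv).2 hc₀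
  rw [eq_neg_iff_add_eq_zero, add_comm, ← eq_neg_iff_add_eq_zero]
  refine inv_eq_left_inv ?_
  rw [slopeMat_eq e f hv, gram_projAlong H hf hc, one_mul, graphMat, ← neg_smul, smul_mul_smul_comm,
    nonsing_inv_mul _ ((isUnit_iff_isUnit_det _).1 hu)]
  simp

/-- Here the signature enters the index: R = −N⁻¹, and arctan of the inverse is traded for π/2 times
the signature minus arctan. -/
theorem phase_eq [FiniteDimensional ℂ S] {e f : Fin n → S} (H : IsDarboux h e f)
    {P₀ P₁ Q : UManifold h} (he : IsFrame P₀ e) (hf : IsFrame P₁ f) (hc₀ : Compl Q P₀)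
    (hc : Compl Q P₁) :
    phase e f Q = 2 * arctanTrace (graphMat e P₁ Q) -
      Real.pi * sign (matForm (graphMat e P₁ Q)) := by
  have hR := isHermitian_graphMat H hf hc
  have h1 := arctanTrace_add_arctanTrace_inv hR ((isUnit_graphMat H he hf hc).2 hc₀)
  rw [phase, slopeMat_eq_neg_inv H he hf hc₀ hc, arctanTrace_neg hR.inv]
  linear_combination -2 * h1

/-- The family `f + τ d`. -/
def lineFam (f d : Fin n → S) (τ : ℝ) (i : Fin n) : S := f i + (τ : ℂ) • d i

theorem gram_lineFam (f d v : Fin n → S) (τ : ℝ) :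
    gram h (lineFam f d τ) v = gram h f v + (τ : ℂ) • gram h d v := by
  ext i j
  change h (f i + (τ : ℂ) • d i) (v j) = h (f i) (v j) + (τ : ℂ) * h (d i) (v j)
  rw [map_add, LinearMap.add_apply, LinearMap.map_smulₛₗ, Complex.conj_ofReal,
    LinearMap.smul_apply, smul_eq_mul]

theorem tendsto_gram_lineFam {ι : Type*} {F : Filter ι} {Q : ι → UManifold h} {Q₀ : UManifold h}
    {w : UManifold h → Fin n → S} {τ : ι → ℝ} {τ₀ : ℝ} (hQ : Tendsto Q F (𝓝 Q₀))
    (hτ : Tendsto τ F (𝓝 τ₀))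
    (hw : ∀ g : Fin n → S, Tendsto (fun Q => gram h g (w Q)) (𝓝 Q₀) (𝓝 (gram h g (w Q₀))))
    (f d : Fin n → S) :
    Tendsto (fun x => gram h (lineFam f d (τ x)) (w (Q x))) F
      (𝓝 (gram h (lineFam f d τ₀) (w Q₀))) := by
  simp only [gram_lineFam]
  exact ((hw f).comp hQ).add
    (((Complex.continuous_ofReal.tendsto _).comp hτ).smul ((hw d).comp hQ))

/-- The Darboux basis may move along with the point, which is what comparing two choices of `f`
requires; `d = 0` is the case of a fixed basis. -/
theorem tendsto_unitaryDet [FiniteDimensional ℂ S] (hh : IsSuperhermitian h) {e f d : Fin n → S}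
    (H : ∀ τ, IsDarboux h e (lineFam f d τ)) {ι : Type*} {F : Filter ι} {Q : ι → UManifold h}
    {Q₀ : UManifold h} {τ : ι → ℝ} {τ₀ : ℝ} (hQ : Tendsto Q F (𝓝 Q₀)) (hτ : Tendsto τ F (𝓝 τ₀)) :
    Tendsto (fun x => unitaryDet e (lineFam f d (τ x)) (Q x)) F
      (𝓝 (unitaryDet e (lineFam f d τ₀) Q₀)) := by
  obtain ⟨w, hw, hwt⟩ := exists_local_frame hh (H 0).card Q₀
  have hX := tendsto_gram_lineFam hQ hτ hwt f d
  have hY := (hwt e).comp hQ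
  rw [(H τ₀).unitaryDet_eq hw.self_of_nhds]
  refine Tendsto.congr' ((hQ.eventually hw).mono fun x hx => ((H (τ x)).unitaryDet_eq hx).symm) ?_
  refine Tendsto.div ?_ ?_ ((H τ₀).det_sub_ne_zero hw.self_of_nhds)
  · exact ((continuous_id.matrix_det).tendsto _).comp (hX.add hY)
  · exact ((continuous_id.matrix_det).tendsto _).comp (hX.sub hY)

theorem tendsto_phase [FiniteDimensional ℂ S] (hh : IsSuperhermitian h) {e f d : Fin n → S}
    (H : ∀ τ, IsDarboux h e (lineFam f d τ)) {P₀ : UManifold h} (he : IsFrame P₀ e) {ι : Type*}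
    {F : Filter ι} {Q : ι → UManifold h} {Q₀ : UManifold h} {τ : ι → ℝ} {τ₀ : ℝ}
    (hQ : Tendsto Q F (𝓝 Q₀)) (hτ : Tendsto τ F (𝓝 τ₀)) (hc : Compl Q₀ P₀) :
    Tendsto (fun x => phase e (lineFam f d (τ x)) (Q x)) F
      (𝓝 (phase e (lineFam f d τ₀) Q₀)) := by
  obtain ⟨w, hw, hwt⟩ := exists_local_frame hh (H 0).card Q₀
  have hX := tendsto_gram_lineFam hQ hτ hwt f d
  have hY := (hwt e).comp hQ
  have hcx : ∀ᶠ x in F, Compl (Q x) P₀ :=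
    hQ.eventually ((isOpen_compl hh P₀).mem_nhds hc)
  have hHerm : ∀ τ Q, Compl Q P₀ → (slopeMat e (lineFam f d τ) Q).IsHermitian := by
    intro τ Q hQ
    rw [slopeMat_eq_graphMat (H τ) he hQ]
    exact isHermitian_graphMat (H τ).swap he hQ
  refine (tendsto_arctanTrace (hcx.mono fun x hx => hHerm _ _ hx) (hHerm _ _ hc) ?_).const_mul 2
  rw [slopeMat_eq _ _ hw.self_of_nhds]
  refine Tendsto.congr' ((hQ.eventually hw).mono fun x hx => (slopeMat_eq _ _ hx).symm) ?_
  exact (hX.mul (tendsto_matrix_inv (((H 0).isUnit_gram_iff he hw.self_of_nhds).2 hc) hY)).const_smul _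

end Index

/-! ### Construction of an index satisfying the axioms -/

section Existence

variable {S : Type*} [AddCommGroup S] [Module ℂ S] {h : S →ₗ⋆[ℂ] S →ₗ[ℂ] ℂ} {n : ℕ}

/-- `m` is the winding number of the path `p`, corrected by the phases at its endpoints. -/
def WindsPath (e f : Fin n → S) (a b : ℝ) (p : ℝ → UManifold h) (m : ℤ) : Prop :=
  Winds a b (fun t => unitaryDet e f (p t)) (phase e f (p a)) (phase e f (p b)) m

open Classical in
/-- The Edwards-Maslov index of a path, computed in a Darboux basis. -/
def windingIndex (e f : Fin n → S) (a b : ℝ) (p : ℝ → UManifold h) : ℤ :=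
  if hm : ∃ m, WindsPath e f a b p m then hm.choose else 0

theorem WindsPath.windingIndex_eq {e f : Fin n → S} {a b : ℝ} (hab : a ≤ b)
    {p : ℝ → UManifold h} {m : ℤ} (hm : WindsPath e f a b p m) : windingIndex e f a b p = m := by
  have hex : ∃ m, WindsPath e f a b p m := ⟨m, hm⟩
  rw [windingIndex, dif_pos hex]
  exact Winds.unique hab hex.choose_spec hm

theorem WindsPath.congr {e f : Fin n → S} {a b : ℝ} (hab : a ≤ b) {p q : ℝ → UManifold h} {m : ℤ}
    (hm : WindsPath e f a b p m) (hpq : ∀ t ∈ Icc a b, p t = q t) : WindsPath e f a b q m := by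
  obtain ⟨θ, hθ, hθD, h1⟩ := hm
  refine ⟨θ, hθ, fun t ht => ?_, ?_⟩
  · rw [hθD t ht]
    exact congrArg _ (hpq t ht)
  · rw [h1, hpq a (left_mem_Icc.2 hab), hpq b (right_mem_Icc.2 hab)]

theorem lineFam_zero_right (f : Fin n → S) (τ : ℝ) : lineFam f 0 τ = f := by
  ext i
  simp [lineFam]

theorem lineFam_zero (f d : Fin n → S) : lineFam f d 0 = f := by
  ext i
  simp [lineFam]

theorem lineFam_one (f d : Fin n → S) : lineFam f d 1 = f + d := by
  ext i
  simp [lineFam]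

theorem exists_windsPath [FiniteDimensional ℂ S] (hh : IsSuperhermitian h) {e f : Fin n → S}
    (H : IsDarboux h e f) {P₀ : UManifold h} (he : IsFrame P₀ e) {a b : ℝ} (hab : a ≤ b)
    {p : ℝ → UManifold h} (hp : ContinuousOn p (Icc a b)) (hadm : IsAdmissible P₀ a b p) :
    ∃ m, WindsPath e f a b p m := by
  refine exists_winds hab (fun t ht => ?_) (fun t _ => H.unitaryDet_ne_zero _)
    (unitaryDet_eq_phase H he (notMem_variety_iff.1 hadm.1))
    (unitaryDet_eq_phase H he (notMem_variety_iff.1 hadm.2))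
  have h1 := tendsto_unitaryDet hh (e := e) (f := f) (d := 0) (τ := fun _ => 0) (τ₀ := 0)
    (fun τ => by rwa [lineFam_zero_right]) (hp t ht) tendsto_const_nhds
  simp only [lineFam_zero_right] at h1
  exact h1

/-- Path and Darboux basis are deformed simultaneously. The endpoints stay complementary to `P₀`, so
the phases vary continuously and the constant (−1)ⁿ is the same throughout. -/
theorem windingIndex_homotopy [FiniteDimensional ℂ S] (hh : IsSuperhermitian h) {e f d : Fin n → S}
    (H : ∀ τ, IsDarboux h e (lineFam f d τ)) {P₀ : UManifold h} (he : IsFrame P₀ e) {a b : ℝ}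
    (hab : a ≤ b) {p : ℝ → ℝ → UManifold h}
    (hp : ContinuousOn (fun x : ℝ × ℝ => p x.1 x.2) (Icc 0 1 ×ˢ Icc a b))
    (hadm : ∀ s ∈ Icc (0 : ℝ) 1, IsAdmissible P₀ a b (p s)) :
    windingIndex e f a b (p 0) = windingIndex e (f + d) a b (p 1) := by
  have hsec : ∀ s ∈ Icc (0 : ℝ) 1, ContinuousOn (p s) (Icc a b) := fun s hs =>
    hp.comp (f := fun t => (s, t)) (by fun_prop) fun t ht => ⟨hs, ht⟩
  have hsec' : ∀ t ∈ Icc a b, ContinuousOn (fun s => p s t) (Icc 0 1) := fun t ht =>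
    hp.comp (f := fun s => (s, t)) (by fun_prop) fun s hs => ⟨hs, ht⟩
  have h0 : (0 : ℝ) ∈ Icc (0 : ℝ) 1 := by simp
  have h1 : (1 : ℝ) ∈ Icc (0 : ℝ) 1 := by simp
  obtain ⟨m₀, hm₀⟩ := exists_windsPath hh (H 0) he hab (hsec 0 h0) (hadm 0 h0)
  obtain ⟨m₁, hm₁⟩ := exists_windsPath hh (H 1) he hab (hsec 1 h1) (hadm 1 h1)
  have hm : m₀ = m₁ := by
    refine Winds.homotopy hab (D := fun s t => unitaryDet e (lineFam f d s) (p s t))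
      (α := fun s => phase e (lineFam f d s) (p s a))
      (β := fun s => phase e (lineFam f d s) (p s b)) (κ := (-1) ^ n) ?_ ?_ ?_ ?_ ?_ ?_ hm₀ hm₁
    · intro x hx
      exact tendsto_unitaryDet hh H (hp x hx) (continuous_fst.continuousWithinAt)
    · exact fun s _ t _ => (H s).unitaryDet_ne_zero _
    · intro s hs
      exact tendsto_phase hh H he (hsec' a (left_mem_Icc.2 hab) s hs) continuousWithinAt_id
        (notMem_variety_iff.1 (hadm s hs).1)
    · intro s hs
      exact tendsto_phase hh H he (hsec' b (right_mem_Icc.2 hab) s hs) continuousWithinAt_id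
        (notMem_variety_iff.1 (hadm s hs).2)
    · exact fun s hs => unitaryDet_eq_phase (H s) he (notMem_variety_iff.1 (hadm s hs).1)
    · exact fun s hs => unitaryDet_eq_phase (H s) he (notMem_variety_iff.1 (hadm s hs).2)
  rw [lineFam_zero] at hm₀
  rw [lineFam_one] at hm₁
  rw [hm₀.windingIndex_eq hab, hm₁.windingIndex_eq hab, hm]

/-- Both families are dual to `e`, so `f' - f` has values in `P₀` and the term of degree 2 in τ of
the Gram matrix of f + τ(f' − f) vanishes. The linear term vanishes because the Gram matrix is zero
at τ = 1. Hence the whole segment consists of Darboux bases. -/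
theorem windingIndex_eq_of_darboux [FiniteDimensional ℂ S] (hh : IsSuperhermitian h)
    {e f f' : Fin n → S} (H : IsDarboux h e f) (H' : IsDarboux h e f') {P₀ : UManifold h}
    (he : IsFrame P₀ e) {a b : ℝ} (hab : a ≤ b) {p : ℝ → UManifold h}
    (hp : ContinuousOn p (Icc a b)) (hadm : IsAdmissible P₀ a b p) :
    windingIndex e f a b p = windingIndex e f' a b p := by
  have hd : ∀ i j, h (f i) (f' j - f j) + h (f' i - f i) (f j) = 0 := by
    intro i j
    have hdd : h (f' i - f i) (f' j - f j) = 0 := by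
      have hmem : ∀ i, f' i - f i ∈ P₀.1 := by
        intro i
        rw [← H.expansion (f' i - f i)]
        have : ∀ k, h (e k) (f' i - f i) = 0 := fun k => by rw [map_sub, H.dual, H'.dual, sub_self]
        simp only [this, zero_smul, Finset.sum_const_zero, add_zero]
        exact he.sum_mem _
      exact apply_eq_zero hh.symm P₀.2.2 (hmem i) (hmem j)
    have h1 := H'.right i j
    have h2 := H.right i j
    simp only [map_sub, LinearMap.sub_apply] at hdd ⊢
    linear_combination h1 - hdd - h2
  have HL : ∀ τ, IsDarboux h e (lineFam f (f' - f) τ) := by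
    intro τ
    refine ⟨H.symm, H.left, fun i j => ?_, fun i j => ?_, H.card⟩
    · have hdd : h (f' i - f i) (f' j - f j) = 0 := by
        have h1 := H'.right i j
        have h2 := H.right i j
        have h3 := hd i j
        simp only [map_sub, LinearMap.sub_apply] at h3 ⊢
        linear_combination h1 - h3 - h2
      change h (f i + (τ : ℂ) • (f' i - f i)) (f j + (τ : ℂ) • (f' j - f j)) = 0
      simp only [map_add, LinearMap.add_apply, LinearMap.map_smulₛₗ, LinearMap.smul_apply,
        smul_eq_mul, H.right, hdd, Complex.conj_ofReal, RingHom.id_apply]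
      linear_combination (τ : ℂ) * hd i j
    · change h (e i) (f j + (τ : ℂ) • (f' j - f j)) = _
      rw [map_add, map_smul, map_sub, H.dual, H'.dual]
      simp
  have := windingIndex_homotopy hh HL he hab (p := fun _ => p)
    (hp.comp continuousOn_snd fun x hx => hx.2) fun _ _ => hadm
  rwa [add_sub_cancel] at this

theorem continuousOn_graphMat_path [FiniteDimensional ℂ S] {e f : Fin n → S}
    (H : IsDarboux h e f) {P₀ P₁ : UManifold h} (he : IsFrame P₀ e) (hf : IsFrame P₁ f)
    (hPP : Compl P₀ P₁) {s : Set ℝ} {p : ℝ → UManifold h} (hp : ContinuousOn p s)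
    (hc : ∀ t ∈ s, Compl (p t) P₁) : ContinuousOn (fun t => graphMat e P₁ (p t)) s :=
  (continuousOn_graphMat H he hf hPP).comp hp hc

theorem sign_graphMat_eq [FiniteDimensional ℂ S] {e f : Fin n → S}
    (H : IsDarboux h e f) {P₀ P₁ : UManifold h} (he : IsFrame P₀ e) (hf : IsFrame P₁ f)
    (hPP : Compl P₀ P₁) {s : Set ℝ} (hs : IsPreconnected s) {p : ℝ → UManifold h}
    (hp : ContinuousOn p s) (hc : ∀ t ∈ s, Compl (p t) P₁) (hc₀ : ∀ t ∈ s, Compl (p t) P₀)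
    {x y : ℝ} (hx : x ∈ s) (hy : y ∈ s) :
    sign (matForm (graphMat e P₁ (p x))) = sign (matForm (graphMat e P₁ (p y))) := by
  refine hs.constant (f := fun t => sign (matForm (graphMat e P₁ (p t)))) (fun t ht => ?_) hx hy
  have h1 := eventually_sign_eq (F := 𝓝[s] t) (M := fun t => graphMat e P₁ (p t))
    (eventually_mem_nhdsWithin.mono fun u hu => isHermitian_graphMat H hf (hc u hu))
    (isHermitian_graphMat H hf (hc t ht)) ((isUnit_graphMat H he hf (hc t ht)).2 (hc₀ t ht))
    (continuousOn_graphMat_path H he hf hPP hp hc t ht)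
  exact tendsto_const_nhds.congr' (h1.mono fun u hu => hu.2.symm)

/-- In one chart 2i tr arctan N is an explicit logarithm; the arctangents cancel against those in
the phases, leaving only the signatures. -/
theorem two_mul_windingIndex [FiniteDimensional ℂ S] (hh : IsSuperhermitian h) {e f : Fin n → S}
    (H : IsDarboux h e f) {P₀ P₁ : UManifold h} (he : IsFrame P₀ e) (hf : IsFrame P₁ f)
    (hPP : Compl P₀ P₁) {a b : ℝ} (hab : a ≤ b) {p : ℝ → UManifold h}
    (hp : ContinuousOn p (Icc a b)) (hadm : IsAdmissible P₀ a b p)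
    (hc : ∀ t ∈ Icc a b, Compl (p t) P₁) :
    2 * windingIndex e f a b p =
      sign (matForm (graphMat e P₁ (p b))) - sign (matForm (graphMat e P₁ (p a))) := by
  obtain ⟨m, hm⟩ := exists_windsPath hh H he hab hp hadm
  rw [hm.windingIndex_eq hab]
  have hcont : ContinuousOn (fun t => arctanTrace (graphMat e P₁ (p t))) (Icc a b) := fun t ht =>
    tendsto_arctanTrace
      (eventually_mem_nhdsWithin.mono fun u hu => isHermitian_graphMat H hf (hc u hu))
      (isHermitian_graphMat H hf (hc t ht)) (continuousOn_graphMat_path H he hf hPP hp hc t ht)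
  have ha := left_mem_Icc.2 hab
  have hb := right_mem_Icc.2 hab
  have h1 := Winds.of_lift hab hm
    (θ := fun t => 2 * Complex.I * arctanTrace (graphMat e P₁ (p t)))
    (continuousOn_const.mul (Complex.continuous_ofReal.comp_continuousOn hcont))
    (fun t ht => (unitaryDet_eq_exp H hf (hc t ht)).symm)
  rw [phase_eq H he hf (notMem_variety_iff.1 hadm.1) (hc a ha),
    phase_eq H he hf (notMem_variety_iff.1 hadm.2) (hc b hb)] at h1
  have h2 : ((2 * m : ℂ)) * (Complex.I * Real.pi) =
      ((sign (matForm (graphMat e P₁ (p b))) : ℂ) - sign (matForm (graphMat e P₁ (p a)))) *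
        (Complex.I * Real.pi) := by
    push_cast at h1
    linear_combination -h1
  have h3 : Complex.I * Real.pi ≠ 0 :=
    mul_ne_zero Complex.I_ne_zero (by exact_mod_cast Real.pi_ne_zero)
  have h4 := mul_right_cancel₀ h3 h2
  exact_mod_cast h4

theorem isEMIndex_windingIndex [FiniteDimensional ℂ S] (hh : IsSuperhermitian h) {e f : Fin n → S}
    (H : IsDarboux h e f) {P₀ : UManifold h} (he : IsFrame P₀ e) :
    IsEMIndex P₀ (windingIndex (h := h) e f) where
  homotopy a b hab Hp p₀ p₁ hcont hadm h0 h1 := by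
    have hmem0 : (0 : ℝ) ∈ Icc (0 : ℝ) 1 := by simp
    have hmem1 : (1 : ℝ) ∈ Icc (0 : ℝ) 1 := by simp
    have hsec : ∀ s ∈ Icc (0 : ℝ) 1, ContinuousOn (Hp s) (Icc a b) := fun s hs =>
      hcont.comp (f := fun t => (s, t)) (by fun_prop) fun t ht => ⟨hs, ht⟩
    have key := windingIndex_homotopy hh (e := e) (f := f) (d := 0)
      (fun τ => by rwa [lineFam_zero_right]) he hab.le hcont hadm
    rw [add_zero] at key
    obtain ⟨m₀, hm₀⟩ := exists_windsPath hh H he hab.le (hsec 0 hmem0) (hadm 0 hmem0)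
    obtain ⟨m₁, hm₁⟩ := exists_windsPath hh H he hab.le (hsec 1 hmem1) (hadm 1 hmem1)
    rw [(hm₀.congr hab.le h0).windingIndex_eq hab.le, (hm₁.congr hab.le h1).windingIndex_eq hab.le,
      ← hm₀.windingIndex_eq hab.le, ← hm₁.windingIndex_eq hab.le, key]
  catenation a c b hac hcb p hp hadm hc := by
    obtain ⟨m, hm⟩ := exists_windsPath hh H he (hac.trans hcb).le hp hadm
    obtain ⟨m₀, hm₀⟩ := exists_windsPath hh H he hac.le
      (hp.mono (Icc_subset_Icc_right hcb.le)) ⟨hadm.1, hc⟩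
    obtain ⟨m₁, hm₁⟩ := exists_windsPath hh H he hcb.le
      (hp.mono (Icc_subset_Icc_left hac.le)) ⟨hc, hadm.2⟩
    rw [hm.windingIndex_eq (hac.trans hcb).le, hm₀.windingIndex_eq hac.le,
      hm₁.windingIndex_eq hcb.le]
    exact Winds.trans hac.le hcb.le hm₀ hm₁ hm
  localization P₁ hPP a b t₀ ht₀ p hp hadm hc hcross _ ε hε hεa hεb := by
    have hab := (ht₀.1.trans ht₀.2).le
    obtain ⟨f', hf', H'⟩ := exists_darboux hh hPP he
    have hc₀ : ∀ t ∈ Icc a b, t ≠ t₀ → Compl (p t) P₀ := fun t ht hne =>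
      notMem_variety_iff.1 fun hv => hne (hcross t ht hv)
    have hsub1 : Icc a (t₀ - ε) ⊆ Icc a b := Icc_subset_Icc_right (by linarith)
    have hsub2 : Icc (t₀ + ε) b ⊆ Icc a b := Icc_subset_Icc_left (by linarith)
    -- There are no crossings on [a, t₀ − ε] or [t₀ + ε, b], so the signatures at the endpoints are
    -- those at t₀ ∓ ε.
    have e1 := sign_graphMat_eq H' he hf' hPP isPreconnected_Icc (hp.1.mono hsub1)
      (fun t ht => hc t (hsub1 ht))
      (fun t ht => hc₀ t (hsub1 ht) (by have := ht.2; intro h; linarith))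
      (left_mem_Icc.2 hεa) (right_mem_Icc.2 hεa)
    have e2 := sign_graphMat_eq H' he hf' hPP isPreconnected_Icc (hp.1.mono hsub2)
      (fun t ht => hc t (hsub2 ht))
      (fun t ht => hc₀ t (hsub2 ht) (by have := ht.1; intro h; linarith))
      (left_mem_Icc.2 hεb) (right_mem_Icc.2 hεb)
    rw [windingIndex_eq_of_darboux hh H H' he hab hp.1 hadm,
      two_mul_windingIndex hh H' he hf' hPP hab hp.1 hadm hc, e1, ← e2,
      sign_chart hh.symm he (hc _ (hsub2 (left_mem_Icc.2 hεb))),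
      sign_chart hh.symm he (hc _ (hsub1 (right_mem_Icc.2 hεa)))]

theorem isEMIndex_emIndex [FiniteDimensional ℂ S] (hh : IsSuperhermitian h) (P₀ : UManifold h) :
    IsEMIndex P₀ (emIndex P₀) := by
  obtain ⟨n, hn⟩ := hh.even_dim
  obtain ⟨P₁, hP₁⟩ := exists_compl hh P₀
  obtain ⟨e, he⟩ := exists_frame P₀ hn.symm
  obtain ⟨f, -, H⟩ := exists_darboux hh hP₁ he
  exact Classical.epsilon_spec (p := IsEMIndex P₀) ⟨_, isEMIndex_windingIndex hh H he⟩

end Existence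

/-! ### Crossing forms in matrix coordinates -/

section Crossings

variable {S : Type*} [AddCommGroup S] [Module ℂ S] {h : S →ₗ⋆[ℂ] S →ₗ[ℂ] ℂ} {n : ℕ}

theorem sign_eq_zero_of_subsingleton {V : Type*} [AddCommGroup V] [Module ℂ V] [Subsingleton V]
    (Q : V → ℝ) : sign Q = 0 := by
  have h1 := posIndex_add_posIndex_neg_le Q
  rw [finrank_zero_of_subsingleton] at h1
  rw [sign]
  omega

theorem eventually_compl [FiniteDimensional ℂ S] (hh : IsSuperhermitian h) {s : Set ℝ}
    {p : ℝ → UManifold h} (hp : ContinuousOn p s) {t₀ : ℝ} (ht₀ : t₀ ∈ s) {P₁ : UManifold h}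
    (hc : Compl (p t₀) P₁) : ∀ᶠ t in 𝓝[s] t₀, Compl (p t) P₁ :=
  (hp t₀ ht₀).eventually ((isOpen_compl hh P₁).mem_nhds hc)

theorem differentiable_graphMat [FiniteDimensional ℂ S] (hh : IsSuperhermitian h) {e f : Fin n → S}
    (H : IsDarboux h e f) {P P₁ : UManifold h} (he : IsFrame P e) (hf : IsFrame P₁ f)
    (hPP : Compl P P₁) {a b : ℝ} {p : ℝ → UManifold h} (hp : IsDifferentiablePath a b p)
    {t₀ : ℝ} (ht₀ : t₀ ∈ Icc a b) (hc : Compl (p t₀) P₁) (i j : Fin n) :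
    DifferentiableWithinAt ℝ (fun t => graphMat e P₁ (p t) i j) (Icc a b) t₀ := by
  have hch : ∀ u : P.1, DifferentiableWithinAt ℝ (fun t => ((chart P P₁ (p t) u : ℝ) : ℂ))
      (Icc a b) t₀ := fun u =>
    Complex.ofRealCLM.differentiableAt.comp_differentiableWithinAt t₀
      (hp.2 t₀ ht₀ P P₁ hPP hc u)
  refine DifferentiableWithinAt.congr_of_eventuallyEq ?_
    ((eventually_compl hh hp.1 ht₀ hc).mono fun t ht => graphMat_entry_eq H he hf ht i j)
    (graphMat_entry_eq H he hf hc i j)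
  push_cast
  refine DifferentiableWithinAt.const_mul (DifferentiableWithinAt.sub ?_
    (DifferentiableWithinAt.const_mul ?_ _)) _
  · exact ((hch _).sub (hch _)).sub (hch _)
  · exact ((hch _).sub (hch _)).sub (hch _)

theorem differentiable_projAlong [FiniteDimensional ℂ S] (hh : IsSuperhermitian h) {e f : Fin n → S}
    (H : IsDarboux h e f) {P P₁ : UManifold h} (he : IsFrame P e) (hf : IsFrame P₁ f)
    (hPP : Compl P P₁) {a b : ℝ} {p : ℝ → UManifold h} (hp : IsDifferentiablePath a b p)
    {t₀ : ℝ} (ht₀ : t₀ ∈ Icc a b) (hc : Compl (p t₀) P₁) (l : S →ₗ[ℂ] ℂ) {u : S} (hu : u ∈ P.1) :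
    DifferentiableWithinAt ℝ (fun t => l (projAlong P₁ (p t) u)) (Icc a b) t₀ := by
  obtain ⟨c, rfl⟩ := he.exists_coord hu
  have key : ∀ Q : UManifold h, Compl Q P₁ → l (projAlong P₁ Q (∑ j, c j • e j)) =
      ∑ j, c j * (l (e j) + Complex.I * ∑ i, graphMat e P₁ Q i j * l (f i)) := by
    intro Q hQ
    simp only [map_sum, map_smul, smul_eq_mul, projAlong_eq H hf hQ, map_add]
  refine DifferentiableWithinAt.congr_of_eventuallyEq ?_
    ((eventually_compl hh hp.1 ht₀ hc).mono fun t ht => key _ ht) (key _ hc)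
  refine DifferentiableWithinAt.fun_sum fun j _ => DifferentiableWithinAt.const_mul
    ((differentiableWithinAt_const _).add (DifferentiableWithinAt.const_mul
      (DifferentiableWithinAt.fun_sum fun i _ => DifferentiableWithinAt.mul_const ?_ _) _)) _
  exact differentiable_graphMat hh H he hf hPP hp ht₀ hc i j

theorem hasDerivAt_star_mul {A B : ℝ → ℂ} {t₀ : ℝ} (hA : DifferentiableAt ℝ A t₀)
    (hB : DifferentiableAt ℝ B t₀) (hA0 : A t₀ = 0) (hB0 : B t₀ = 0) :
    HasDerivAt (fun t => star (A t) * B t) 0 t₀ := by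
  have := hA.hasDerivAt.star.fun_mul hB.hasDerivAt
  simpa [hA0, hB0] using this

/-- The derivative of a path in a chart at a vector of the subspace does not depend on the
complement. -/
theorem hasDerivAt_apply_projAlong_sub [FiniteDimensional ℂ S] (hh : IsSuperhermitian h)
    {P P₁ P₂ : UManifold h} (hPP : Compl P P₁) {a b : ℝ}
    {p : ℝ → UManifold h} (hp : IsDifferentiablePath a b p) {t₀ : ℝ} (ht₀ : t₀ ∈ Ioo a b)
    (hc : Compl (p t₀) P₁) (hc₂ : Compl (p t₀) P₂) {u : S} (hu : u ∈ P.1) (hu' : u ∈ (p t₀).1) :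
    HasDerivAt (fun t => h u (projAlong P₂ (p t) u - projAlong P₁ (p t) u)) 0 t₀ := by
  have hIcc := Ioo_subset_Icc_self ht₀
  have hnhds : Icc a b ∈ 𝓝 t₀ := Icc_mem_nhds ht₀.1 ht₀.2
  obtain ⟨n, hn⟩ := hh.even_dim
  obtain ⟨e, he⟩ := exists_frame P hn.symm
  obtain ⟨f, hf, H⟩ := exists_darboux hh hPP he
  obtain ⟨e₂, he₂⟩ := exists_frame (p t₀) hn.symm
  obtain ⟨f₂, hf₂, H₂⟩ := exists_darboux hh hc₂ he₂
  have hd1 : ∀ l : S →ₗ[ℂ] ℂ, DifferentiableAt ℝ (fun t => l (projAlong P₁ (p t) u)) t₀ := fun l =>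
    (differentiable_projAlong hh H he hf hPP hp hIcc hc l hu).differentiableAt hnhds
  have hd2 : ∀ l : S →ₗ[ℂ] ℂ, DifferentiableAt ℝ (fun t => l (projAlong P₂ (p t) u)) t₀ := fun l =>
    (differentiable_projAlong hh H₂ he₂ hf₂ hc₂ hp hIcc hc₂ l hu').differentiableAt hnhds
  have hA : ∀ l : S →ₗ[ℂ] ℂ, DifferentiableAt ℝ (fun t => l (u - projAlong P₁ (p t) u)) t₀ := by
    intro l
    simp only [map_sub]
    exact (differentiableAt_const _).sub (hd1 l)
  have hB : ∀ l : S →ₗ[ℂ] ℂ,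
      DifferentiableAt ℝ (fun t => l (projAlong P₂ (p t) u - projAlong P₁ (p t) u)) t₀ := by
    intro l
    simp only [map_sub]
    exact (hd2 l).sub (hd1 l)
  have hA0 : u - projAlong P₁ (p t₀) u = 0 := by rw [projAlong_of_mem hc hu', sub_self]
  have hB0 : projAlong P₂ (p t₀) u - projAlong P₁ (p t₀) u = 0 := by
    rw [projAlong_of_mem hc hu', projAlong_of_mem hc₂ hu', sub_self]
  -- Both projections lie in the isotropic `p t`, so u may be replaced by u minus its projection
  -- along `P₁`. Every term is then a product of two factors vanishing at t₀ and has derivative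
  -- zero.
  have hsum : ∀ t, h u (projAlong P₂ (p t) u - projAlong P₁ (p t) u) =
      ∑ i, (star (h (f i) (u - projAlong P₁ (p t) u)) *
          h (e i) (projAlong P₂ (p t) u - projAlong P₁ (p t) u) +
        star (h (e i) (u - projAlong P₁ (p t) u)) *
          h (f i) (projAlong P₂ (p t) u - projAlong P₁ (p t) u)) := by
    intro t
    rw [← H.apply_eq, map_sub h, LinearMap.sub_apply, apply_eq_zero hh.symm (p t).2.2
      (projAlong_mem P₁ (p t) u) ((p t).1.sub_mem (projAlong_mem P₂ (p t) u)
        (projAlong_mem P₁ (p t) u)), sub_zero]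
  simp only [hsum]
  have := HasDerivAt.fun_sum (u := Finset.univ) fun (i : Fin n) _ =>
    (hasDerivAt_star_mul (hA (h (f i))) (hB (h (e i))) (by rw [hA0, map_zero])
      (by rw [hB0, map_zero])).fun_add
    (hasDerivAt_star_mul (hA (h (e i))) (hB (h (f i))) (by rw [hA0, map_zero])
      (by rw [hB0, map_zero]))
  simpa using this

/-- Besides changing the complement, this moves the base of the chart from `p t₀` to a fixed `P`, on
vectors common to both; with `P = P₀` the crossing form is read in the chart used for localization.
-/
theorem tangentForm_eq [FiniteDimensional ℂ S] (hh : IsSuperhermitian h)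
    {P P₁ : UManifold h} (hPP : Compl P P₁) {a b : ℝ}
    {p : ℝ → UManifold h} (hp : IsDifferentiablePath a b p) {t₀ : ℝ} (ht₀ : t₀ ∈ Ioo a b)
    (hc : Compl (p t₀) P₁) {u : S} (hu : u ∈ P.1) (hu' : u ∈ (p t₀).1) :
    tangentForm p t₀ ⟨u, hu'⟩ = deriv (fun t => chart P P₁ (p t) ⟨u, hu⟩) t₀ := by
  have hnhds : Icc a b ∈ 𝓝 t₀ := Icc_mem_nhds ht₀.1 ht₀.2
  have hc₂ := compl_complement hh (p t₀)
  have h1 := hasDerivAt_apply_projAlong_sub hh hPP hp ht₀ hc hc₂ hu hu'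
  have h2 : HasDerivAt (fun t => 2 * (-Complex.I *
      h u (projAlong (complement (p t₀)) (p t) u - projAlong P₁ (p t) u)).re) 0 t₀ := by
    have h3 := (Complex.reCLM.hasFDerivAt.comp_hasDerivAt t₀
      (h1.const_mul (-Complex.I))).const_mul (2 : ℝ)
    simpa using h3
  have hdiff : DifferentiableAt ℝ (fun t => chart P P₁ (p t) ⟨u, hu⟩) t₀ :=
    (hp.2 t₀ (Ioo_subset_Icc_self ht₀) P P₁ hPP hc ⟨u, hu⟩).differentiableAt hnhds
  have hev : ∀ᶠ t in 𝓝 t₀, chart (p t₀) (complement (p t₀)) (p t) ⟨u, hu'⟩ =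
      chart P P₁ (p t) ⟨u, hu⟩ + 2 * (-Complex.I *
        h u (projAlong (complement (p t₀)) (p t) u - projAlong P₁ (p t) u)).re := by
    have e1 := eventually_compl hh hp.1 (Ioo_subset_Icc_self ht₀) hc
    have e2 := eventually_compl hh hp.1 (Ioo_subset_Icc_self ht₀) hc₂
    rw [nhdsWithin_eq_nhds.2 hnhds] at e1 e2
    filter_upwards [e1, e2] with t ht1 ht2
    rw [chart_eq hh.symm _ ht1, chart_eq hh.symm _ ht2, map_sub, mul_sub, Complex.sub_re]
    ring
  rw [tangentForm]
  have h4 := (hdiff.hasDerivAt.fun_add h2).congr_of_eventuallyEq hev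
  rw [h4.deriv, add_zero]

theorem hasDerivWithinAt_matForm {N : ℝ → Matrix (Fin n) (Fin n) ℂ}
    {N' : Matrix (Fin n) (Fin n) ℂ} {s : Set ℝ} {t₀ : ℝ}
    (hN : ∀ i j, HasDerivWithinAt (fun t => N t i j) (N' i j) s t₀) (c : Fin n → ℂ) :
    HasDerivWithinAt (fun t => matForm (N t) c) (matForm N' c) s t₀ := by
  have h1 : HasDerivWithinAt (fun t => ∑ i, star (c i) * ∑ j, N t i j * c j)
      (∑ i, star (c i) * ∑ j, N' i j * c j) s t₀ :=
    HasDerivWithinAt.fun_sum fun i _ => HasDerivWithinAt.const_mul _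
      (HasDerivWithinAt.fun_sum fun j _ => (hN i j).mul_const _)
  exact Complex.reCLM.hasFDerivAt.comp_hasDerivWithinAt t₀ h1

/-- For a kernel vector with sum u, the projection of u to `Q` minus u is orthogonal to both `e` and
`f`, hence zero; so u itself lies in `Q`. -/
theorem mem_ker_graphMat [FiniteDimensional ℂ S] {e f : Fin n → S} (H : IsDarboux h e f)
    {P P₁ Q : UManifold h} (he : IsFrame P e) (hf : IsFrame P₁ f) (hc : Compl Q P₁)
    (c : Fin n → ℂ) : c ∈ LinearMap.ker (graphMat e P₁ Q).mulVecLin ↔ ∑ j, c j • e j ∈ Q.1 := by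
  have hmv : ∀ i, (graphMat e P₁ Q *ᵥ c) i =
      -Complex.I * h (e i) (projAlong P₁ Q (∑ j, c j • e j)) := fun i => by
    rw [graphMat, smul_mulVec, Pi.smul_apply, gram_mulVec, smul_eq_mul,
      map_sum (projAlong P₁ Q)]
    simp only [map_smul]
  have heu : ∀ i, h (e i) (∑ j, c j • e j) = 0 := fun i =>
    apply_eq_zero H.symm P.2.2 (he.mem i) (he.sum_mem c)
  constructor
  · intro h0
    have h1 : ∀ i, h (e i) (projAlong P₁ Q (∑ j, c j • e j)) = 0 := fun i => by
      have := congrFun (show graphMat e P₁ Q *ᵥ c = 0 from h0) i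
      rw [hmv, Pi.zero_apply] at this
      simpa using this
    have h2 : projAlong P₁ Q (∑ j, c j • e j) - ∑ j, c j • e j = 0 := by
      rw [← H.expansion (projAlong P₁ Q (∑ j, c j • e j) - ∑ j, c j • e j)]
      have h3 : ∀ i, h (f i) (projAlong P₁ Q (∑ j, c j • e j) - ∑ j, c j • e j) = 0 := fun i =>
        apply_eq_zero H.symm P₁.2.2 (hf.mem i) (projAlong_sub_mem hc _)
      have h4 : ∀ i, h (e i) (projAlong P₁ Q (∑ j, c j • e j) - ∑ j, c j • e j) = 0 := fun i => by
        rw [map_sub, h1, heu, sub_zero]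
      simp only [h3, h4, zero_smul, Finset.sum_const_zero, add_zero]
    rw [← sub_eq_zero.1 h2]
    exact projAlong_mem _ _ _
  · intro hmem
    change graphMat e P₁ Q *ᵥ c = 0
    ext i
    rw [hmv, projAlong_of_mem hc hmem, heu, mul_zero, Pi.zero_apply]

/-- The kernel of the coordinate matrix is the intersection with the base point. -/
def kerEquiv [FiniteDimensional ℂ S] {e f : Fin n → S} (H : IsDarboux h e f)
    {P P₁ Q : UManifold h} (he : IsFrame P e) (hf : IsFrame P₁ f) (hc : Compl Q P₁) :
    LinearMap.ker (graphMat e P₁ Q).mulVecLin ≃ₗ[ℂ] (Q.1 ⊓ P.1 : Submodule ℂ S) :=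
  LinearEquiv.ofBijective
    (((Fintype.linearCombination ℂ e).domRestrict _).codRestrict (Q.1 ⊓ P.1) fun c => by
      rw [LinearMap.domRestrict_apply, Fintype.linearCombination_apply]
      exact ⟨(mem_ker_graphMat H he hf hc _).1 c.2, he.sum_mem _⟩)
    ⟨by
      refine (injective_iff_map_eq_zero _).2 fun c hc => Subtype.ext (he.sum_eq_zero ?_)
      have := congrArg Subtype.val hc
      rwa [LinearMap.codRestrict_apply, LinearMap.domRestrict_apply,
        Fintype.linearCombination_apply] at this,
    fun x => by
      obtain ⟨c, hx⟩ := he.exists_coord x.2.2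
      have hmem : ∑ j, c j • e j ∈ Q.1 := hx ▸ x.2.1
      refine ⟨⟨c, (mem_ker_graphMat H he hf hc _).2 hmem⟩, Subtype.ext ?_⟩
      rw [LinearMap.codRestrict_apply, LinearMap.domRestrict_apply,
        Fintype.linearCombination_apply]
      exact hx.symm⟩

theorem crossingForm_kerEquiv [FiniteDimensional ℂ S] (hh : IsSuperhermitian h) {e f : Fin n → S}
    (H : IsDarboux h e f) {P₀ P₁ : UManifold h} (he : IsFrame P₀ e) (hf : IsFrame P₁ f)
    (hPP : Compl P₀ P₁) {a b : ℝ} {p : ℝ → UManifold h} (hp : IsDifferentiablePath a b p)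
    {t₀ : ℝ} (ht₀ : t₀ ∈ Ioo a b) (hc : Compl (p t₀) P₁) {N' : Matrix (Fin n) (Fin n) ℂ}
    (hN : ∀ i j, HasDerivWithinAt (fun t => graphMat e P₁ (p t) i j) (N' i j) (Icc a b) t₀)
    (c : LinearMap.ker (graphMat e P₁ (p t₀)).mulVecLin) :
    crossingForm p P₀ t₀ (kerEquiv H he hf hc c) = 2 * matForm N' c := by
  have hnhds : Icc a b ∈ 𝓝 t₀ := Icc_mem_nhds ht₀.1 ht₀.2
  rw [crossingForm, tangentForm_eq hh hPP hp ht₀ hc (kerEquiv H he hf hc c).2.2]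
  have h1 := ((hasDerivWithinAt_matForm hN c).hasDerivAt hnhds).const_mul (2 : ℝ)
  refine HasDerivAt.deriv (h1.congr_of_eventuallyEq ?_)
  have e1 := eventually_compl hh hp.1 (Ioo_subset_Icc_self ht₀) hc
  rw [nhdsWithin_eq_nhds.2 hnhds] at e1
  filter_upwards [e1] with t ht
  rw [← chart_equiv hh.symm he ht]
  congr 1

end Crossings

/-! ### Local signatures and summation over crossings -/

section Localization

variable {S : Type*} [AddCommGroup S] [Module ℂ S] {h : S →ₗ⋆[ℂ] S →ₗ[ℂ] ℂ} {n : ℕ}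

/-- The sign of `η` selects the side of t. The difference quotients tend to `η • N'`, so the jump
lemma applies with differentiability at the single instant t. -/
theorem eventually_sign_side {N : ℝ → Matrix (Fin n) (Fin n) ℂ} {N' : Matrix (Fin n) (Fin n) ℂ}
    {s : Set ℝ} {t η : ℝ} (hη : η ≠ 0)
    (hN : ∀ i j, HasDerivWithinAt (fun x => N x i j) (N' i j) s t)
    (hH : ∀ᶠ x in 𝓝[s] t, (N x).IsHermitian) (hHt : (N t).IsHermitian) (hN' : N'.IsHermitian)
    (hmem : ∀ᶠ x in 𝓝[>] (0 : ℝ), t + η * x ∈ s)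
    (hK : IsNonsingular fun k : LinearMap.ker (N t).mulVecLin => matForm (η • N') k) :
    ∀ᶠ x in 𝓝[>] (0 : ℝ), IsUnit (N (t + η * x)) ∧ sign (matForm (N (t + η * x))) =
      sign (matForm (N t)) + sign fun k : LinearMap.ker (N t).mulVecLin => matForm (η • N') k := by
  have hne : ∀ᶠ x in 𝓝[>] (0 : ℝ), t + η * x ∈ s \ {t} := by
    filter_upwards [hmem, self_mem_nhdsWithin] with x hx hx0
    refine ⟨hx, fun heq => ?_⟩
    have : η * x = 0 := by
      have : t + η * x = t := heq
      linarith
    exact (mul_ne_zero hη (ne_of_gt hx0)) this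
  have hto : Tendsto (fun x : ℝ => t + η * x) (𝓝[>] 0) (𝓝 t) := by
    have : Continuous fun x : ℝ => t + η * x := by fun_prop
    have := (this.tendsto 0).mono_left (nhdsWithin_le_nhds (s := Ioi 0))
    simpa using this
  have hlim : Tendsto (fun x : ℝ => t + η * x) (𝓝[>] 0) (𝓝[s \ {t}] t) :=
    tendsto_nhdsWithin_iff.2 ⟨hto, hne⟩
  have hlim' : Tendsto (fun x : ℝ => t + η * x) (𝓝[>] 0) (𝓝[s] t) :=
    tendsto_nhdsWithin_iff.2 ⟨hto, hmem⟩
  have hB : Tendsto (fun x : ℝ => x⁻¹ • (N (t + η * x) - N t)) (𝓝[>] 0) (𝓝 (η • N')) := by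
    refine tendsto_pi_nhds.2 fun i => tendsto_pi_nhds.2 fun j => ?_
    have h1 := ((hasDerivWithinAt_iff_tendsto_slope.1 (hN i j)).comp hlim).const_smul η
    refine h1.congr fun x => ?_
    simp only [Function.comp_apply, slope, vsub_eq_sub, add_sub_cancel_left, _root_.mul_inv_rev, smul_smul,
      Matrix.smul_apply, Matrix.sub_apply]
    congr 1
    field_simp
  have hHN' : (η • N').IsHermitian := by
    rw [IsHermitian, conjTranspose_smul, hN'.eq]
    simp
  have hev := hlim'.eventually hH
  have h2 := eventually_sign_jump hHt hHN' (hev.mono fun x hx => by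
    rw [IsHermitian, conjTranspose_smul, conjTranspose_sub, hx.eq, hHt.eq]
    simp) hB hK
  filter_upwards [h2, self_mem_nhdsWithin] with x hx hx0
  have h3 : N t + x • x⁻¹ • (N (t + η * x) - N t) = N (t + η * x) := by
    rw [smul_smul, mul_inv_cancel₀ (ne_of_gt hx0), one_smul, add_sub_cancel]
  rwa [h3] at hx

/-- `σ` is the signature at t itself. The case of no crossing is included: the crossing form then
lives on the zero space and contributes 0, which also covers the endpoints. -/
theorem exists_local_signs [FiniteDimensional ℂ S] (hh : IsSuperhermitian h) (P₀ : UManifold h)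
    {a b : ℝ} (hab : a < b) {p : ℝ → UManifold h} (hp : IsDifferentiablePath a b p) {t : ℝ}
    (ht : t ∈ Icc a b)
    (hreg : p t ∈ variety P₀ → t ∈ Ioo a b ∧ IsNonsingular (crossingForm p P₀ t)) :
    ∃ P₁ : UManifold h, Compl P₀ P₁ ∧ ∃ σ : ℤ, ∃ δ > 0, ∀ s ∈ Icc a b, |s - t| < δ →
      Compl (p s) P₁ ∧ (s ≠ t → p s ∉ variety P₀) ∧
      (t < s → sign (chart P₀ P₁ (p s)) = σ + sign (crossingForm p P₀ t)) ∧
      (s < t → sign (chart P₀ P₁ (p s)) = σ - sign (crossingForm p P₀ t)) := by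
  obtain ⟨P₁, hPP, hc⟩ := exists_common_compl hh P₀ (p t)
  obtain ⟨n, hn⟩ := hh.even_dim
  obtain ⟨e, he⟩ := exists_frame P₀ hn.symm
  obtain ⟨f, hf, H⟩ := exists_darboux hh hPP he
  let N : ℝ → Matrix (Fin n) (Fin n) ℂ := fun s => graphMat e P₁ (p s)
  let N' : Matrix (Fin n) (Fin n) ℂ :=
    Matrix.of fun i j => derivWithin (fun s => N s i j) (Icc a b) t
  have hN : ∀ i j, HasDerivWithinAt (fun s => N s i j) (N' i j) (Icc a b) t := fun i j =>
    (differentiable_graphMat hh H he hf hPP hp ht hc i j).hasDerivWithinAt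
  have hcev := eventually_compl hh hp.1 ht hc
  have hH : ∀ᶠ s in 𝓝[Icc a b] t, (N s).IsHermitian :=
    hcev.mono fun s hs => isHermitian_graphMat H hf hs
  have hHt : (N t).IsHermitian := isHermitian_graphMat H hf hc
  have hN' : N'.IsHermitian := by
    ext i j
    rw [conjTranspose_apply]
    refine (uniqueDiffOn_Icc hab t ht).eq_deriv _ ?_ (hN i j)
    refine (hN j i).star.congr_of_eventuallyEq (hH.mono fun s hs => ?_) ?_
    · exact (hs.apply i j).symm
    · exact (hHt.apply i j).symm
  set K := LinearMap.ker (N t).mulVecLin with hKdef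
  have hKform : IsNonsingular (fun k : K => matForm N' k) ∧
      sign (fun k : K => matForm N' k) = sign (crossingForm p P₀ t) := by
    by_cases hv : p t ∈ variety P₀
    · obtain ⟨ht', hns⟩ := hreg hv
      have hcr := crossingForm_kerEquiv hh H he hf hPP hp ht' hc hN
      refine ⟨fun v hv0 => ?_, (sign_congr (kerEquiv H he hf hc) two_pos hcr).symm⟩
      refine (kerEquiv H he hf hc).map_eq_zero_iff.1 (hns _ fun w => ?_)
      obtain ⟨w, rfl⟩ := (kerEquiv H he hf hc).surjective w
      rw [← map_add, hcr, hcr, hcr]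
      have := hv0 w
      simp only at this
      rw [this, mul_add]
    · have hbot : (p t).1 ⊓ P₀.1 = ⊥ := (notMem_variety_iff.1 hv).inf_eq_bot
      have : Subsingleton ((p t).1 ⊓ P₀.1 : Submodule ℂ S) := by
        rw [hbot]
        infer_instance
      have : Subsingleton K := (kerEquiv H he hf hc).toEquiv.subsingleton
      exact ⟨fun v _ => Subsingleton.elim _ _, by
        rw [sign_eq_zero_of_subsingleton, sign_eq_zero_of_subsingleton]⟩
  have hside : ∀ η : ℝ, η = 1 ∨ η = -1 → ∃ δ > 0, ∀ x ∈ Ioo 0 δ, t + η * x ∈ Icc a b →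
      IsUnit (N (t + η * x)) ∧ sign (matForm (N (t + η * x))) =
        sign (matForm (N t)) + sign fun k : K => matForm (η • N') k := by
    intro η hη
    have hη0 : η ≠ 0 := by rcases hη with rfl | rfl <;> norm_num
    have hKη : IsNonsingular fun k : K => matForm (η • N') k := by
      rcases hη with rfl | rfl
      · simpa using hKform.1
      · intro v hv
        refine hKform.1 v fun w => ?_
        have := hv w
        simp only [neg_smul, one_smul, matForm_neg] at this ⊢
        linarith
    -- The real alternative is whether [a, b] extends from t in direction `η`. If not, t is an
    -- endpoint and the claim is vacuous for any δ.
    by_cases hend : t + η * 1 = t + η ∧ ∃ y > 0, t + η * y ∈ Icc a b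
    · obtain ⟨-, y, hy, hymem⟩ := hend
      have hmem : ∀ᶠ x in 𝓝[>] (0 : ℝ), t + η * x ∈ Icc a b := by
        filter_upwards [Ioo_mem_nhdsGT hy] with x hx
        rcases hη with rfl | rfl
        · exact ⟨by linarith [ht.1, hx.1], by linarith [hymem.2, hx.2]⟩
        · exact ⟨by linarith [hymem.1, hx.2], by linarith [ht.2, hx.1]⟩
      have hev := eventually_sign_side hη0 hN hH hHt hN' hmem hKη
      obtain ⟨δ, hδ, hsub⟩ := mem_nhdsGT_iff_exists_Ioo_subset.1 hev
      exact ⟨δ, hδ, fun x hx _ => hsub hx⟩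
    · refine ⟨1, one_pos, fun x hx hxm => absurd ⟨by ring, x, hx.1, hxm⟩ hend⟩
  obtain ⟨δ₁, hδ₁, hright⟩ := hside 1 (Or.inl rfl)
  obtain ⟨δ₂, hδ₂, hleft⟩ := hside (-1) (Or.inr rfl)
  obtain ⟨δ₃, hδ₃, hcompl⟩ := Metric.mem_nhdsWithin_iff.1 hcev
  have hunit : ∀ s, Compl (p s) P₁ → IsUnit (N s) → p s ∉ variety P₀ := fun s hs hu =>
    notMem_variety_iff.2 ((isUnit_graphMat H he hf hs).1 hu)
  refine ⟨P₁, hPP, sign (matForm (N t)), min δ₃ (min δ₁ δ₂), by positivity, fun s hs hst => ?_⟩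
  have h3 : |s - t| < δ₃ := hst.trans_le (min_le_left _ _)
  have h1 : |s - t| < δ₁ := hst.trans_le ((min_le_right _ _).trans (min_le_left _ _))
  have h2 : |s - t| < δ₂ := hst.trans_le ((min_le_right _ _).trans (min_le_right _ _))
  have hcs : Compl (p s) P₁ := hcompl ⟨by rwa [Metric.mem_ball, Real.dist_eq], hs⟩
  have hR : t < s → IsUnit (N s) ∧ sign (matForm (N s)) =
      sign (matForm (N t)) + sign fun k : K => matForm N' k := by
    intro hlt
    have e1 : t + 1 * (s - t) = s := by ring
    have := hright (s - t) ⟨by linarith, (abs_lt.1 h1).2⟩ (by rwa [e1])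
    rwa [e1, one_smul] at this
  have hL : s < t → IsUnit (N s) ∧ sign (matForm (N s)) =
      sign (matForm (N t)) - sign fun k : K => matForm N' k := by
    intro hlt
    have e1 : t + (-1) * (t - s) = s := by ring
    have := hleft (t - s) ⟨by linarith, by linarith [(abs_lt.1 h2).1]⟩ (by rwa [e1])
    rw [e1] at this
    simp only [neg_smul, one_smul, matForm_neg, sign_neg] at this
    exact this
  refine ⟨hcs, fun hne => ?_, fun hlt => ?_, fun hlt => ?_⟩
  · rcases hne.lt_or_gt with hlt | hlt
    · exact hunit s hcs (hL hlt).1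
    · exact hunit s hcs (hR hlt).1
  · rw [sign_chart hh.symm he hcs, ← hKform.2]
    exact (hR hlt).2
  · rw [sign_chart hh.symm he hcs, ← hKform.2]
    exact (hL hlt).2

theorem IsDifferentiablePath.mono {a b c d : ℝ} {p : ℝ → UManifold h}
    (hp : IsDifferentiablePath a b p) (hsub : Icc c d ⊆ Icc a b) : IsDifferentiablePath c d p :=
  ⟨hp.1.mono hsub, fun t ht P P₁ hPP hc u => (hp.2 t (hsub ht) P P₁ hPP hc u).mono hsub⟩

/-- The crossings in an open interval. -/
def crossings (P₀ : UManifold h) (p : ℝ → UManifold h) (c d : ℝ) : Set ℝ :=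
  {t | t ∈ Ioo c d ∧ p t ∈ variety P₀}

theorem exists_local_formula [FiniteDimensional ℂ S] (hh : IsSuperhermitian h) (P₀ : UManifold h)
    {μ : ℝ → ℝ → (ℝ → UManifold h) → ℤ} (hμ : IsEMIndex P₀ μ)
    {a b : ℝ} (hab : a < b) {p : ℝ → UManifold h} (hp : IsDifferentiablePath a b p)
    (hadm : IsAdmissible P₀ a b p) (hreg : HasOnlyRegularCrossings P₀ a b p) {t : ℝ}
    (ht : t ∈ Icc a b) :
    ∃ δ > 0, (∀ s ∈ Icc a b, |s - t| < δ → s ≠ t → p s ∉ variety P₀) ∧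
      ∀ c ∈ Icc a b, ∀ d ∈ Icc a b, c < d → |c - t| < δ → |d - t| < δ → IsAdmissible P₀ c d p →
        μ c d p = ∑ᶠ s ∈ crossings P₀ p c d, sign (crossingForm p P₀ s) := by
  have hreg' : p t ∈ variety P₀ → t ∈ Ioo a b ∧ IsNonsingular (crossingForm p P₀ t) := by
    intro hv
    refine ⟨⟨lt_of_le_of_ne ht.1 ?_, lt_of_le_of_ne ht.2 ?_⟩, hreg t ht hv⟩
    · rintro rfl
      exact hadm.1 hv
    · rintro rfl
      exact hadm.2 hv
  obtain ⟨P₁, hPP, σ, δ, hδ, hloc⟩ := exists_local_signs hh P₀ hab hp ht hreg'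
  refine ⟨δ, hδ, fun s hs hst => (hloc s hs hst).2.1, fun c hc d hd hcd hct hdt hadm' => ?_⟩
  have hsub : Icc c d ⊆ Icc a b := fun s hs => ⟨hc.1.trans hs.1, hs.2.trans hd.2⟩
  have hnear : ∀ s ∈ Icc c d, |s - t| < δ := fun s hs =>
    abs_lt.2 ⟨by linarith [(abs_lt.1 hct).1, hs.1], by linarith [(abs_lt.1 hdt).2, hs.2]⟩
  have hcomp : ∀ s ∈ Icc c d, Compl (p s) P₁ := fun s hs => (hloc s (hsub hs) (hnear s hs)).1
  have honly : ∀ s ∈ Icc c d, p s ∈ variety P₀ → s = t := fun s hs hv => by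
    by_contra hne
    exact (hloc s (hsub hs) (hnear s hs)).2.1 hne hv
  have hreg'' : HasOnlyRegularCrossings P₀ c d p := fun s hs => hreg s (hsub hs)
  have hplus : ∀ s ∈ Icc c d, t < s → sign (chart P₀ P₁ (p s)) = σ + sign (crossingForm p P₀ t) :=
    fun s hs => (hloc s (hsub hs) (hnear s hs)).2.2.1
  have hminus : ∀ s ∈ Icc c d, s < t → sign (chart P₀ P₁ (p s)) = σ - sign (crossingForm p P₀ t) :=
    fun s hs => (hloc s (hsub hs) (hnear s hs)).2.2.2
  by_cases htcd : t ∈ Ioo c d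
  · have hε : 0 < min (t - c) (d - t) := lt_min (by linarith [htcd.1]) (by linarith [htcd.2])
    have h1 : c ≤ t - min (t - c) (d - t) := by linarith [min_le_left (t - c) (d - t)]
    have h2 : t + min (t - c) (d - t) ≤ d := by linarith [min_le_right (t - c) (d - t)]
    -- Twice the index is (σ + γ) − (σ − γ), with γ the signature of the crossing form at t.
    have key := hμ.localization P₁ hPP c d t htcd p (hp.mono hsub) hadm' hcomp honly hreg'' _ hε h1 h2
    rw [hplus _ ⟨by linarith, h2⟩ (by linarith), hminus _ ⟨h1, by linarith⟩ (by linarith)] at key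
    have key' : μ c d p = sign (crossingForm p P₀ t) := by omega
    rw [key']
    by_cases hv : p t ∈ variety P₀
    · have : crossings P₀ p c d = {t} := by
        ext s
        simp only [crossings, mem_ofPred_eq, mem_singleton_iff]
        constructor
        · exact fun hs => honly s (Ioo_subset_Icc_self hs.1) hs.2
        · rintro rfl
          exact ⟨htcd, hv⟩
      rw [this, finsum_mem_singleton]
    · have : crossings P₀ p c d = ∅ := by
        refine eq_empty_iff_forall_notMem.2 fun s hs => hv ?_
        rw [← honly s (Ioo_subset_Icc_self hs.1) hs.2]
        exact hs.2
      have hbot : (p t).1 ⊓ P₀.1 = ⊥ := (notMem_variety_iff.1 hv).inf_eq_bot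
      have hsing : Subsingleton ((p t).1 ⊓ P₀.1 : Submodule ℂ S) := by
        rw [hbot]
        infer_instance
      rw [this, finsum_mem_empty, sign_eq_zero_of_subsingleton]
  · have hnone : ∀ s ∈ Icc c d, p s ∉ variety P₀ := by
      intro s hs hv
      obtain rfl := honly s hs hv
      rcases hs.1.eq_or_lt with rfl | h1
      · exact hadm'.1 hv
      · rcases hs.2.eq_or_lt with rfl | h2
        · exact hadm'.2 hv
        · exact htcd ⟨h1, h2⟩
    have hempty : crossings P₀ p c d = ∅ :=
      eq_empty_iff_forall_notMem.2 fun s hs => hnone s (Ioo_subset_Icc_self hs.1) hs.2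
    -- Without crossings any interior instant may play the role of t₀. The midpoint and a quarter of
    -- the length keep both sample points on the same side of t, where the signatures agree, so the
    -- index is 0.
    have key := hμ.localization P₁ hPP c d ((c + d) / 2) ⟨by linarith, by linarith⟩ p (hp.mono hsub)
      hadm' hcomp (fun s hs hv => absurd hv (hnone s hs)) hreg'' ((d - c) / 4) (by linarith)
      (by linarith) (by linarith)
    have hm1 : (c + d) / 2 + (d - c) / 4 ∈ Icc c d := ⟨by linarith, by linarith⟩
    have hm2 : (c + d) / 2 - (d - c) / 4 ∈ Icc c d := ⟨by linarith, by linarith⟩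
    rw [hempty, finsum_mem_empty]
    by_cases htc : t ≤ c
    · rw [hplus _ hm1 (by linarith), hplus _ hm2 (by linarith)] at key
      omega
    · have htd : d ≤ t := by
        by_contra hlt
        exact htcd ⟨not_le.1 htc, not_le.1 hlt⟩
      rw [hminus _ hm1 (by linarith), hminus _ hm2 (by linarith)] at key
      omega

/-- Only the axioms on `μ` are used, so the formula applies to whichever map the choice in `emIndex`
picks. -/
theorem finite_crossings_and_formula [FiniteDimensional ℂ S] (hh : IsSuperhermitian h)
    (P₀ : UManifold h) {μ : ℝ → ℝ → (ℝ → UManifold h) → ℤ} (hμ : IsEMIndex P₀ μ)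
    {a b : ℝ} (hab : a < b) {p : ℝ → UManifold h} (hp : IsDifferentiablePath a b p)
    (hadm : IsAdmissible P₀ a b p) (hreg : HasOnlyRegularCrossings P₀ a b p) :
    (crossings P₀ p a b).Finite ∧
      μ a b p = ∑ᶠ t ∈ crossings P₀ p a b, sign (crossingForm p P₀ t) := by
  choose δ hδ hiso hloc using fun t : Icc a b =>
    exists_local_formula hh P₀ hμ hab hp hadm hreg t.2
  -- Every instant has a neighbourhood containing no other crossing; compactness makes the set of
  -- crossings finite.
  have hfin : {t | t ∈ Icc a b ∧ p t ∈ variety P₀}.Finite := by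
    have : (Icc a b ∩ {t | t ∈ Icc a b ∧ p t ∈ variety P₀}).Finite :=
      IsCompact.induction_on (p := fun s => (s ∩ {t | t ∈ Icc a b ∧ p t ∈ variety P₀}).Finite)
      isCompact_Icc (by simp)
      (fun s t hst ht => ht.subset (inter_subset_inter_left _ hst))
      (fun s t hs ht => by rw [union_inter_distrib_right]; exact hs.union ht)
      (fun t ht => by
        refine ⟨Metric.ball t (δ ⟨t, ht⟩), mem_nhdsWithin_of_mem_nhds
          (Metric.ball_mem_nhds t (hδ ⟨t, ht⟩)), (finite_singleton t).subset ?_⟩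
        rintro s ⟨hs, hsI, hsv⟩
        by_contra hne
        rw [Metric.mem_ball, Real.dist_eq] at hs
        exact hiso ⟨t, ht⟩ s hsI hs hne hsv)
    exact this.subset fun t ht => ⟨ht.1, ht⟩
  have hfin' : ∀ c ∈ Icc a b, ∀ d ∈ Icc a b, (crossings P₀ p c d).Finite := fun c hc d hd =>
    hfin.subset fun t ht => ⟨⟨hc.1.trans ht.1.1.le, ht.1.2.le.trans hd.2⟩, ht.2⟩
  obtain ⟨ε, hε, hleb⟩ := lebesgue_number_lemma_of_metric (isCompact_Icc (a := a) (b := b))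
    (c := fun t : Icc a b => Metric.ball (t : ℝ) (δ t)) (fun _ => Metric.isOpen_ball)
    (fun t ht => mem_iUnion.2 ⟨⟨t, ht⟩, Metric.mem_ball_self (hδ _)⟩)
  have hshort : ∀ c ∈ Icc a b, ∀ d ∈ Icc a b, c < d → d - c < ε → IsAdmissible P₀ c d p →
      μ c d p = ∑ᶠ s ∈ crossings P₀ p c d, sign (crossingForm p P₀ s) := by
    intro c hc d hd hcd hlt hadm'
    obtain ⟨t, ht⟩ := hleb c hc
    have h1 := ht (Metric.mem_ball_self hε)
    have h2 := ht (show d ∈ Metric.ball c ε by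
      rw [Metric.mem_ball, Real.dist_eq, abs_of_pos (by linarith)]
      exact hlt)
    rw [Metric.mem_ball, Real.dist_eq] at h1 h2
    exact hloc t c hc d hd hcd h1 h2 hadm'
  have hall : ∀ k : ℕ, ∀ c ∈ Icc a b, ∀ d ∈ Icc a b, c < d → d - c < (k + 1) * (ε / 2) →
      IsAdmissible P₀ c d p →
      μ c d p = ∑ᶠ s ∈ crossings P₀ p c d, sign (crossingForm p P₀ s) := by
    intro k
    induction k with
    | zero =>
      intro c hc d hd hcd hlt hadm'
      refine hshort c hc d hd hcd ?_ hadm'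
      simp only [Nat.cast_zero, zero_add, one_mul] at hlt
      linarith
    | succ k ih =>
      intro c hc d hd hcd hlt hadm'
      by_cases hs : d - c < ε
      · exact hshort c hc d hd hcd hs hadm'
      push Not at hs
      push_cast at hlt
      -- The cut x must leave [x, d] shorter than ε and [c, x] within the length bound of the
      -- induction hypothesis; the open interval of such x is infinite, so x can avoid the finitely
      -- many crossings.
      have hint : d - ε < min d (c + (k + 1) * (ε / 2)) := lt_min (by linarith) (by linarith)
      obtain ⟨x, hx, hxv⟩ := (Ioo_infinite hint).exists_notMem_finset hfin.toFinset
      have hxc : c < x := by linarith [hx.1]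
      have hxd : x < d := hx.2.trans_le (min_le_left _ _)
      have hx2 : x < c + (k + 1) * (ε / 2) := hx.2.trans_le (min_le_right _ _)
      have hxI : x ∈ Icc a b := ⟨hc.1.trans hxc.le, hxd.le.trans hd.2⟩
      have hxn : p x ∉ variety P₀ := fun hv => hxv (hfin.mem_toFinset.2 ⟨hxI, hv⟩)
      have hunion : crossings P₀ p c d = crossings P₀ p c x ∪ crossings P₀ p x d := by
        ext s
        constructor
        · rintro ⟨hsI, hsv⟩
          rcases lt_trichotomy s x with h1 | rfl | h1
          · exact Or.inl ⟨⟨hsI.1, h1⟩, hsv⟩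
          · exact absurd hsv hxn
          · exact Or.inr ⟨⟨h1, hsI.2⟩, hsv⟩
        · rintro (⟨hsI, hsv⟩ | ⟨hsI, hsv⟩)
          · exact ⟨⟨hsI.1, hsI.2.trans hxd⟩, hsv⟩
          · exact ⟨⟨hxc.trans hsI.1, hsI.2⟩, hsv⟩
      have hdisj : Disjoint (crossings P₀ p c x) (crossings P₀ p x d) :=
        disjoint_left.2 fun s h1 h2 => lt_asymm h1.1.2 h2.1.1
      rw [hμ.catenation c x d hxc hxd p (hp.1.mono (Icc_subset_Icc hc.1 hd.2)) hadm' hxn,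
        ih c hc x hxI hxc (by linarith) ⟨hadm'.1, hxn⟩,
        hshort x hxI d hd hxd (by linarith [hx.1]) ⟨hxn, hadm'.2⟩, hunion,
        finsum_mem_union hdisj (hfin' c hc x hxI) (hfin' x hxI d hd)]
  have ha := left_mem_Icc.2 hab.le
  have hb := right_mem_Icc.2 hab.le
  obtain ⟨k, hk⟩ := exists_nat_gt ((b - a) / (ε / 2))
  rw [div_lt_iff₀ (by positivity)] at hk
  refine ⟨hfin' a ha b hb, hall k a ha b hb hab (hk.trans ?_) hadm⟩
  exact mul_lt_mul_of_pos_right (lt_add_one _) (by positivity)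

end Localization

end EMIndex

end

theorem mainTheorem3 {S : Type*} [AddCommGroup S] [Module ℂ S] [FiniteDimensional ℂ S]
    (h : S →ₗ⋆[ℂ] S →ₗ[ℂ] ℂ) (hh : EMIndex.IsSuperhermitian h) (P₀ : EMIndex.UManifold h) :
    EMIndex.IsEMIndex P₀ (EMIndex.emIndex P₀) ∧
    ∀ (a b : ℝ), a < b → ∀ p : ℝ → EMIndex.UManifold h,
      EMIndex.IsDifferentiablePath a b p → EMIndex.IsAdmissible P₀ a b p →
      EMIndex.HasOnlyRegularCrossings P₀ a b p →
      {t | t ∈ Set.Ioo a b ∧ p t ∈ EMIndex.variety P₀}.Finite ∧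
      EMIndex.emIndex P₀ a b p =
        ∑ᶠ t ∈ {t | t ∈ Set.Ioo a b ∧ p t ∈ EMIndex.variety P₀},
          EMIndex.sign (EMIndex.crossingForm p P₀ t) :=
  ⟨EMIndex.isEMIndex_emIndex hh P₀, fun _ _ hab _ hp hadm hreg =>
    EMIndex.finite_crossings_and_formula hh P₀ (EMIndex.isEMIndex_emIndex hh P₀) hab hp hadm hreg⟩
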